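/- All graphs are finite, simple and undirected. A graph is unicyclic if it is connected and has as many edges as vertices (equivalently, it is connected and contains exactly one cycle). For a graph $G$ with vertices $v_1,\dots,v_n$ and degrees $d_{v_1},\dots,d_{v_n}$, the arithmetic–geometric matrix $A_{ag}(G)$ is the $n\times n$ real symmetric matrix whose $(i,j)$-entry is $\frac{d_{v_i}+d_{v_j}}{2\sqrt{d_{v_i}d_{v_j}}}$ if $v_iv_j$ is an edge and $0$ otherwise; the arithmetic–geometric spectral radius $\rho_{ag}(G)$ is the largest eigenvalue of $A_{ag}(G)$. For $n\ge 5$ let $C_n$ be the cycle of order $n$, and let $S_n+e$ be the graph obtained from the star $S_n$ of order $n$ by adding an edge joining two of its leaves (the same construction defines $S_{n-1}+e$). Let $G_1$ be obtained from a quadrangle $C_4$ by attaching $n-4$ pendent edges at one common vertex, let $G_2$ be obtained from $S_{n-1}+e$ by attaching a pendent edge at a vertex of degree two, and let $G_3$ be obtained from $S_{n-1}+e$ by attaching a pendent edge at a vertex of degree one. All of these are unicyclic graphs of order $n$. Theorem. Let $n\ge 5$. Every unicyclic graph $G$ of order $n$ satisfies $\rho_{ag}(G)\ge\rho_{ag}(C_n)=2$,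 with equality if and only if $G\cong C_n$. Moreover: (i) if $5\le n\le 7$, then $\rho_{ag}(S_n+e)>\rho_{ag}(G_2)>\rho_{ag}(G_3)>\rho_{ag}(G_1)$; (ii) if $8\le n\le 15$, then $\rho_{ag}(S_n+e)>\rho_{ag}(G_2)>\rho_{ag}(G_1)>\rho_{ag}(G_3)$; (iii) if $n\ge 16$, then $\rho_{ag}(S_n+e)>\rho_{ag}(G_1)>\rho_{ag}(G_2)>\rho_{ag}(G_3)$; and in each case every unicyclic graph $G$ of order $n$ that is not isomorphic to one of $S_n+e$, $G_1$, $G_2$, $G_3$ satisfies $\rho_{ag}(G)<\min\{\rho_{ag}(G_1),\rho_{ag}(G_2),\rho_{ag}(G_3)\}$, so that these four graphs are, up to isomorphism and in the stated order, the unique unicyclic graphs of order $n$ with the first four largest arithmetic–geometric spectral radii. -/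

import Mathlib

universe u

namespace AGSpectral

/-- A graph is unicyclic if it is connected and has as many edges as vertices. -/
def IsUnicyclic {V : Type u} [Fintype V] (G : SimpleGraph V) : Prop :=
  G.Connected ∧ G.edgeSet.ncard = Fintype.card V

open scoped Classical in
/-- The arithmetic-geometric matrix of a finite simple graph. -/
noncomputable def agMatrix {V : Type u} [Fintype V] (G : SimpleGraph V) : Matrix V V ℝ :=
  Matrix.of fun i j =>
    if G.Adj i j then
      ((G.degree i : ℝ) + (G.degree j : ℝ)) / (2 * √((G.degree i : ℝ) * (G.degree j : ℝ)))
    else 0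

open scoped Classical in
/-- The arithmetic-geometric spectral radius: the largest eigenvalue of the
arithmetic-geometric matrix. -/
noncomputable def agSpectralRadius {V : Type u} [Fintype V] (G : SimpleGraph V) : ℝ :=
  sSup {μ : ℝ | Module.End.HasEigenvalue (Matrix.toLin' (agMatrix G)) μ}

open scoped Classical in
/-- The supremum in the definition of `agSpectralRadius` is attained. -/
theorem isGreatest_agSpectralRadius {V : Type u} [Fintype V] [Nonempty V] (G : SimpleGraph V) :
    IsGreatest {μ : ℝ | Module.End.HasEigenvalue (Matrix.toLin' (agMatrix G)) μ}
      (agSpectralRadius G) := by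
  have hA : (agMatrix G).IsHermitian := by
    ext i j
    simp only [agMatrix, Matrix.conjTranspose_apply, Matrix.of_apply, star_trivial,
      G.adj_comm j i, add_comm (G.degree j : ℝ), mul_comm (G.degree j : ℝ)]
  have hset : {μ : ℝ | Module.End.HasEigenvalue (Matrix.toLin' (agMatrix G)) μ}
      = Set.range hA.eigenvalues := by
    rw [← hA.spectrum_real_eq_range_eigenvalues, ← Matrix.spectrum_toLin']
    ext μ
    exact Module.End.hasEigenvalue_iff_mem_spectrum
  have hfin : (Set.range hA.eigenvalues).Finite := Set.finite_range _
  have hne : (Set.range hA.eigenvalues).Nonempty := Set.range_nonempty _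
  unfold agSpectralRadius
  rw [hset]
  exact ⟨hne.csSup_mem hfin, fun _ h => le_csSup hfin.bddAbove h⟩

/-- `Sₙ + e`: the star with centre `0`, together with an edge joining the leaves `1` and `2`. -/
def starPlusEdge (n : ℕ) : SimpleGraph (Fin n) :=
  SimpleGraph.fromRel fun i j => i.val = 0 ∨ (i.val = 1 ∧ j.val = 2)

/-- `G₁`: the quadrangle `0 - 1 - 2 - 3 - 0` with the `n - 4` remaining vertices attached
as pendent vertices to `0`. -/
def graphG1 (n : ℕ) : SimpleGraph (Fin n) :=
  SimpleGraph.fromRel fun i j =>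
    (i.val = 0 ∧ j.val = 1) ∨ (i.val = 1 ∧ j.val = 2) ∨ (i.val = 2 ∧ j.val = 3) ∨
      (i.val = 3 ∧ j.val = 0) ∨ (i.val = 0 ∧ 4 ≤ j.val)

/-- `G₂`: the graph `Sₙ₋₁ + e` on the vertices `0, …, n - 2` (centre `0`, extra edge joining
`1` and `2`) with the vertex `n - 1` attached as a pendent vertex to the vertex `1`
of degree two. -/
def graphG2 (n : ℕ) : SimpleGraph (Fin n) :=
  SimpleGraph.fromRel fun i j =>
    (i.val = 0 ∧ j.val + 1 < n) ∨ (i.val = 1 ∧ j.val = 2) ∨ (i.val = 1 ∧ j.val + 1 = n)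

/-- `G₃`: the graph `Sₙ₋₁ + e` on the vertices `0, …, n - 2` (centre `0`, extra edge joining
`1` and `2`) with the vertex `n - 1` attached as a pendent vertex to the vertex `3`
of degree one. -/
def graphG3 (n : ℕ) : SimpleGraph (Fin n) :=
  SimpleGraph.fromRel fun i j =>
    (i.val = 0 ∧ j.val + 1 < n) ∨ (i.val = 1 ∧ j.val = 2) ∨ (i.val = 3 ∧ j.val + 1 = n)

/-- `H` is a unicyclic graph of order `n`, and it is, up to isomorphism, the unique one with the
smallest arithmetic-geometric spectral radius. -/
def IsUniqueSmallest (n : ℕ) (H : SimpleGraph (Fin n)) : Prop :=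
  IsUnicyclic H ∧
    ∀ (V : Type u) [Fintype V] (G : SimpleGraph V), Fintype.card V = n → IsUnicyclic G →
      agSpectralRadius H ≤ agSpectralRadius G ∧
        (agSpectralRadius G = agSpectralRadius H ↔ Nonempty (G ≃g H))

/-- `H₁, H₂, H₃, H₄` are unicyclic graphs of order `n`, their arithmetic-geometric spectral radii
are strictly decreasing, and every unicyclic graph of order `n` that is isomorphic to none of
them has a strictly smaller arithmetic-geometric spectral radius than all of them. -/
def AreUniqueFirstFour (n : ℕ) (H₁ H₂ H₃ H₄ : SimpleGraph (Fin n)) : Prop :=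
  (IsUnicyclic H₁ ∧ IsUnicyclic H₂ ∧ IsUnicyclic H₃ ∧ IsUnicyclic H₄) ∧
    (agSpectralRadius H₂ < agSpectralRadius H₁ ∧ agSpectralRadius H₃ < agSpectralRadius H₂ ∧
      agSpectralRadius H₄ < agSpectralRadius H₃) ∧
    ∀ (V : Type u) [Fintype V] (G : SimpleGraph V), Fintype.card V = n → IsUnicyclic G →
      Nonempty (G ≃g H₁) ∨ Nonempty (G ≃g H₂) ∨ Nonempty (G ≃g H₃) ∨ Nonempty (G ≃g H₄) ∨
        agSpectralRadius G < agSpectralRadius H₄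

end AGSpectral

universe v

namespace AGSpectral

open scoped Matrix

/-! Substituting `x = D^{1/2} z`, with `D` the degree matrix, removes the square roots: with `R =
2ρ`, the eigenvalue equation at `i` reads `∑_{j ~ i} (d_i + d_j) z_j = R d_i z_i`, whose left side
is `agRow`. A positive `z` with `≤` in every row gives `ρ ≤ R/2` (Collatz–Wielandt,
`agSpectralRadius_le_of_agRow_le`). With `≥` in every row and one strict row it gives `ρ > R/2`
(Rayleigh quotient, `lt_agSpectralRadius_of_le_agRow`). Every comparison of spectral radii is made
by putting a rational `R` between two values.

A unicyclic graph with a vertex `c` of degree `n - 1` or `n - 2` has one or two edges avoiding `c`,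
which forces it to be one of the four named graphs. For these, given `R`, the equations at all
vertices except `c` can be solved exactly with `z c = 1`; the side of `R/2` on which `ρ` lies is
then decided by a rational inequality in `R` and `n`, read off at `c`.

All other unicyclic graphs have maximal degree at most `n - 3`. A vertex lies on at most one
triangle, so the degrees of the neighbours of any vertex sum to at most `n + 1`
(`IsUnicyclic.nbrSum_le`). With constant weights the row condition becomes `d + S/d ≤ R` for degree
`d` and neighbour sum `S`. By convexity only `d = 1`, `d = 2` and `d = n - 3` matter, and the last
gives `R = (n - 2) + 4/(n - 3)`. This is below twice the smallest of the four radii once `n ≥ 10`.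
For `n = 6, 7, 8, 9` the constant weights are adjusted according to degrees and neighbour sums, and
for `n = 5` the degrees are at most two.

For the minimum, AM–GM makes every nonzero entry of the matrix at least `1`, so the all-ones vector
has Rayleigh quotient at least `2n/n = 2`. Equality forces adjacent vertices to have equal degrees;
connectedness makes the graph `2`-regular, hence a cycle. -/

/-! ### Spectral bounds from test vectors. -/

open scoped Classical in
theorem agMatrix_apply {V : Type u} [Fintype V] (G : SimpleGraph V) (i j : V) :
    agMatrix G i j = if G.Adj i j then
      ((G.degree i : ℝ) + (G.degree j : ℝ)) / (2 * √((G.degree i : ℝ) * (G.degree j : ℝ)))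
    else 0 := rfl

theorem agMatrix_nonneg {V : Type u} [Fintype V] (G : SimpleGraph V) (i j : V) :
    0 ≤ agMatrix G i j := by
  rw [agMatrix_apply]
  split_ifs <;> positivity

open scoped Classical in
theorem agMatrix_isHermitian {V : Type u} [Fintype V] (G : SimpleGraph V) :
    (agMatrix G).IsHermitian := by
  ext i j
  simp only [agMatrix, Matrix.conjTranspose_apply, Matrix.of_apply, star_trivial,
    G.adj_comm j i, add_comm (G.degree j : ℝ), mul_comm (G.degree j : ℝ)]

open scoped Classical in
theorem exists_eigenvector_agSpectralRadius {V : Type u} [Fintype V] [Nonempty V]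
    (G : SimpleGraph V) :
    ∃ x : V → ℝ, x ≠ 0 ∧ agMatrix G *ᵥ x = agSpectralRadius G • x := by
  obtain ⟨x, hx⟩ := (isGreatest_agSpectralRadius G).1.exists_hasEigenvector
  exact ⟨x, hx.2, by simpa [Matrix.toLin'_apply] using hx.apply_eq_smul⟩

open scoped Classical in
theorem le_agSpectralRadius_of_mulVec_eq {V : Type u} [Fintype V] [Nonempty V]
    (G : SimpleGraph V) {x : V → ℝ} (hx : x ≠ 0) {μ : ℝ} (h : agMatrix G *ᵥ x = μ • x) :
    μ ≤ agSpectralRadius G := by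
  refine (isGreatest_agSpectralRadius G).2 ?_
  refine Module.End.hasEigenvalue_of_hasEigenvector (x := x) ?_
  rw [Module.End.hasEigenvector_iff]
  exact ⟨Module.End.mem_eigenspace_iff.2 (by simpa [Matrix.toLin'_apply] using h), hx⟩

open scoped Classical in
/-- The Rayleigh quotient is bounded by the spectral radius. -/
theorem dotProduct_agMatrix_mulVec_le {V : Type u} [Fintype V] [Nonempty V]
    (G : SimpleGraph V) (x : V → ℝ) :
    x ⬝ᵥ (agMatrix G *ᵥ x) ≤ agSpectralRadius G * (x ⬝ᵥ x) := by
  have hB : (agSpectralRadius G • (1 : Matrix V V ℝ) - agMatrix G).IsHermitian := by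
    refine Matrix.IsHermitian.sub ?_ (agMatrix_isHermitian G)
    ext i j
    by_cases h : i = j
    · subst h; simp
    · simp [h, Ne.symm h]
  have hpsd : (agSpectralRadius G • (1 : Matrix V V ℝ) - agMatrix G).PosSemidef := by
    rw [hB.posSemidef_iff_eigenvalues_nonneg]
    intro i
    have h1 := hB.mulVec_eigenvectorBasis i
    have h2 : (hB.eigenvectorBasis i).ofLp ≠ 0 := by
      have := hB.eigenvectorBasis.orthonormal.ne_zero i
      simpa using this
    -- An eigenvector of `ρ • 1 - A` for `λ` is an eigenvector of `A` for `ρ - λ`; maximality of `ρ`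
    -- then gives `λ ≥ 0`.
    have h3 : agMatrix G *ᵥ (hB.eigenvectorBasis i).ofLp =
        (agSpectralRadius G - hB.eigenvalues i) • (hB.eigenvectorBasis i).ofLp := by
      rw [sub_smul, ← h1, Matrix.sub_mulVec, Matrix.smul_mulVec, Matrix.one_mulVec]
      abel
    have := le_agSpectralRadius_of_mulVec_eq G h2 h3
    simp only [Pi.zero_apply]
    linarith
  have := hpsd.dotProduct_mulVec_nonneg x
  rw [Matrix.sub_mulVec, Matrix.smul_mulVec, Matrix.one_mulVec, dotProduct_sub,
    dotProduct_smul] at this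
  simp only [star_trivial, smul_eq_mul] at this
  linarith

/-- Collatz–Wielandt bound: the eigenvector equation is read at an index maximising `|v i| / x i`,
where nonnegativity of the matrix lets `|v|` be replaced by a multiple of `x`. No Perron vector is
needed. -/
theorem agSpectralRadius_le_of_mulVec_le {V : Type u} [Fintype V] [Nonempty V]
    (G : SimpleGraph V) {x : V → ℝ} (hx : ∀ i, 0 < x i) {r : ℝ}
    (h : ∀ i, (agMatrix G *ᵥ x) i ≤ r * x i) : agSpectralRadius G ≤ r := by
  obtain ⟨v, hv, hev⟩ := exists_eigenvector_agSpectralRadius G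
  obtain ⟨i, -, hi⟩ := Finset.exists_max_image Finset.univ (fun i => |v i| / x i)
    Finset.univ_nonempty
  have hle : ∀ j, |v j| ≤ |v i| / x i * x j := fun j => by
    have := hi j (Finset.mem_univ j)
    rwa [div_le_iff₀ (hx j)] at this
  have hpos : 0 < |v i| := by
    rw [abs_pos]
    intro h0
    apply hv
    ext j
    have := hle j
    rw [h0] at this
    simpa using this
  have h1 : agSpectralRadius G * |v i| ≤ r * |v i| := by
    calc agSpectralRadius G * |v i| ≤ |agSpectralRadius G * v i| := by
            rw [abs_mul]; exact mul_le_mul_of_nonneg_right (le_abs_self _) (abs_nonneg _)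
      _ = |(agMatrix G *ᵥ v) i| := by rw [hev]; simp
      _ ≤ ∑ j, |agMatrix G i j * v j| := by
            simp only [Matrix.mulVec, dotProduct]; exact Finset.abs_sum_le_sum_abs _ _
      _ ≤ ∑ j, |v i| / x i * (agMatrix G i j * x j) := by
            refine Finset.sum_le_sum fun j _ => ?_
            rw [abs_mul, abs_of_nonneg (agMatrix_nonneg G i j)]
            have := mul_le_mul_of_nonneg_left (hle j) (agMatrix_nonneg G i j)
            linarith
      _ = |v i| / x i * (agMatrix G *ᵥ x) i := by
            rw [← Finset.mul_sum]; rfl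
      _ ≤ |v i| / x i * (r * x i) :=
            mul_le_mul_of_nonneg_left (h i) (div_nonneg (abs_nonneg _) (hx i).le)
      _ = r * |v i| := by
            have := (hx i).ne'
            field_simp
  exact le_of_mul_le_mul_right h1 hpos

/-- Pairing `r x ≤ A x` with `x ≥ 0` makes the Rayleigh quotient of `x` exceed `r` as soon as one
coordinate in the support of `x` is strict, so irreducibility plays no role. -/
theorem lt_agSpectralRadius_of_le_mulVec {V : Type u} [Fintype V] [Nonempty V]
    (G : SimpleGraph V) {x : V → ℝ} (hx : ∀ i, 0 ≤ x i) {r : ℝ}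
    (h : ∀ i, r * x i ≤ (agMatrix G *ᵥ x) i) {c : V} (hc : 0 < x c)
    (hlt : r * x c < (agMatrix G *ᵥ x) c) : r < agSpectralRadius G := by
  have h1 := dotProduct_agMatrix_mulVec_le G x
  have h2 : r * (x ⬝ᵥ x) < x ⬝ᵥ (agMatrix G *ᵥ x) := by
    simp only [dotProduct, Finset.mul_sum]
    refine Finset.sum_lt_sum (fun i _ => ?_) ⟨c, Finset.mem_univ c, ?_⟩
    · nlinarith [hx i, h i]
    · nlinarith
  have h3 : 0 < x ⬝ᵥ x := by
    simp only [dotProduct]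
    exact Finset.sum_pos' (fun i _ => mul_self_nonneg _) ⟨c, Finset.mem_univ c, by positivity⟩
  exact lt_of_mul_lt_mul_right (h2.trans_le h1) h3.le

open scoped Classical in
/-- The `i`-th row of `2 D^{1/2} A_ag D^{1/2}`, applied to the vector `z`. -/
noncomputable def agRow {V : Type u} [Fintype V] (G : SimpleGraph V) (z : V → ℝ) (i : V) : ℝ :=
  ∑ j ∈ G.neighborFinset i, ((G.degree i : ℝ) + G.degree j) * z j

-- The change of variables that clears the roots: `(d_i + d_j) / (2√(d_i d_j)) · √d_j z_j = (d_i +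
-- d_j) z_j / (2√d_i)`. From here on `R` stands for twice a candidate spectral radius.
open scoped Classical in
theorem agMatrix_mulVec_sqrt_degree {V : Type u} [Fintype V] (G : SimpleGraph V)
    (z : V → ℝ) (i : V) (hd : 0 < G.degree i) :
    (agMatrix G *ᵥ fun j => √(G.degree j) * z j) i = agRow G z i / (2 * √(G.degree i)) := by
  simp only [Matrix.mulVec, dotProduct, agMatrix_apply, agRow, Finset.sum_div, ite_mul, zero_mul]
  rw [← Finset.sum_filter, ← SimpleGraph.neighborFinset_eq_filter]
  refine Finset.sum_congr rfl fun j hj => ?_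
  rw [SimpleGraph.mem_neighborFinset] at hj
  have hj' : 0 < G.degree j := (G.degree_pos_iff_exists_adj j).2 ⟨i, hj.symm⟩
  have h1 : (0 : ℝ) < √(G.degree i) := Real.sqrt_pos.2 (by exact_mod_cast hd)
  have h2 : (0 : ℝ) < √(G.degree j) := Real.sqrt_pos.2 (by exact_mod_cast hj')
  rw [Real.sqrt_mul (Nat.cast_nonneg _)]
  field_simp

open scoped Classical in
theorem agSpectralRadius_le_of_agRow_le {V : Type u} [Fintype V] [Nonempty V]
    (G : SimpleGraph V) (hd : ∀ i, 0 < G.degree i) {z : V → ℝ} (hz : ∀ i, 0 < z i) {R : ℝ}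
    (h : ∀ i, agRow G z i ≤ R * (G.degree i * z i)) : agSpectralRadius G ≤ R / 2 := by
  have hs : ∀ i, (0 : ℝ) < √(G.degree i) := fun i => Real.sqrt_pos.2 (by exact_mod_cast hd i)
  refine agSpectralRadius_le_of_mulVec_le G (x := fun j => √(G.degree j) * z j)
    (fun i => mul_pos (hs i) (hz i)) fun i => ?_
  rw [agMatrix_mulVec_sqrt_degree G z i (hd i), div_le_iff₀ (by have := hs i; positivity)]
  have := Real.mul_self_sqrt (Nat.cast_nonneg (α := ℝ) (G.degree i))
  calc _ ≤ _ := h i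
    _ = R * ((√(G.degree i) * √(G.degree i)) * z i) := by rw [this]
    _ = _ := by ring

open scoped Classical in
theorem lt_agSpectralRadius_of_le_agRow {V : Type u} [Fintype V] [Nonempty V]
    (G : SimpleGraph V) (hd : ∀ i, 0 < G.degree i) {z : V → ℝ} (hz : ∀ i, 0 < z i) {R : ℝ}
    (h : ∀ i, R * (G.degree i * z i) ≤ agRow G z i) {c : V}
    (hlt : R * (G.degree c * z c) < agRow G z c) : R / 2 < agSpectralRadius G := by
  have hs : ∀ i, (0 : ℝ) < √(G.degree i) := fun i => Real.sqrt_pos.2 (by exact_mod_cast hd i)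
  have key : ∀ i, R / 2 * (√(G.degree i) * z i) * (2 * √(G.degree i)) =
      R * (G.degree i * z i) := fun i => by
    have := Real.mul_self_sqrt (Nat.cast_nonneg (α := ℝ) (G.degree i))
    linear_combination R * z i * this
  refine lt_agSpectralRadius_of_le_mulVec G (x := fun j => √(G.degree j) * z j)
    (fun i => (mul_pos (hs i) (hz i)).le) (fun i => ?_) (c := c) (mul_pos (hs c) (hz c)) ?_
  · rw [agMatrix_mulVec_sqrt_degree G z i (hd i), le_div_iff₀ (by have := hs i; positivity), key]
    exact h i
  · rw [agMatrix_mulVec_sqrt_degree G z c (hd c), lt_div_iff₀ (by have := hs c; positivity), key]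
    exact hlt

open scoped Classical in
theorem agMatrix_iso {V : Type u} {W : Type v} [Fintype V] [Fintype W] {G : SimpleGraph V}
    {H : SimpleGraph W} (e : G ≃g H) (i j : V) : agMatrix H (e i) (e j) = agMatrix G i j := by
  have hd : ∀ k, H.degree (e k) = G.degree k := fun k => by convert e.degree_eq k
  rw [agMatrix_apply, agMatrix_apply, hd, hd]
  simp only [e.map_adj_iff]

theorem agSpectralRadius_le_of_iso {V : Type u} {W : Type v} [Fintype V] [Fintype W] [Nonempty V]
    [Nonempty W] {G : SimpleGraph V} {H : SimpleGraph W} (e : G ≃g H) :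
    agSpectralRadius H ≤ agSpectralRadius G := by
  obtain ⟨x, hx, hev⟩ := exists_eigenvector_agSpectralRadius H
  refine le_agSpectralRadius_of_mulVec_eq G (x := x ∘ e) ?_ ?_
  · intro h
    apply hx
    ext i
    simpa using congrFun h (e.symm i)
  · ext i
    have := congrFun hev (e i)
    simp only [Matrix.mulVec, dotProduct, Pi.smul_apply, smul_eq_mul, Function.comp] at this ⊢
    rw [← this, ← e.toEquiv.sum_comp]
    exact Finset.sum_congr rfl fun j _ => by rw [← agMatrix_iso e]; rfl

theorem agSpectralRadius_eq_of_iso {V : Type u} {W : Type v} [Fintype V] [Fintype W] [Nonempty V]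
    [Nonempty W] {G : SimpleGraph V} {H : SimpleGraph W} (e : G ≃g H) :
    agSpectralRadius G = agSpectralRadius H :=
  le_antisymm (agSpectralRadius_le_of_iso e.symm) (agSpectralRadius_le_of_iso e)

/-! ### Edge counting in unicyclic graphs. -/

theorem reachable_of_forall_adj_reachable {V : Type u} {G H : SimpleGraph V}
    (h : ∀ x y, G.Adj x y → H.Reachable x y) {x y : V} (hxy : G.Reachable x y) :
    H.Reachable x y := by
  obtain ⟨p⟩ := hxy
  induction p with
  | nil => exact SimpleGraph.Reachable.refl _
  | cons hadj _ ih => exact (h _ _ hadj).trans ih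

/-- In a unicyclic graph, a vertex lies on at most one triangle. -/
theorem IsUnicyclic.edge_unique_of_subset_neighborSet {V : Type u} [Fintype V]
    {G : SimpleGraph V} (hG : IsUnicyclic G) {c a b a' b' : V} (ha : G.Adj c a) (hb : G.Adj c b)
    (hab : G.Adj a b) (ha' : G.Adj c a') (hb' : G.Adj c b') (hab' : G.Adj a' b') :
    s(a, b) = s(a', b') := by
  by_contra hne
  -- Deleting the edges opposite `c` in two different triangles keeps the graph connected, since
  -- both can be bypassed through `c`. Only `n - 2` edges would remain, too few for connectedness.
  have hcon : (G.deleteEdges {s(a, b), s(a', b')}).Connected := by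
    have := hG.1.nonempty
    have hc : ∀ x, G.Adj c x → (G.deleteEdges {s(a, b), s(a', b')}).Adj c x := by
      intro x hx
      rw [SimpleGraph.deleteEdges_adj]
      refine ⟨hx, ?_⟩
      simp only [Set.mem_insert_iff, Set.mem_singleton_iff, Sym2.eq_iff]
      rintro ((⟨rfl, -⟩ | ⟨rfl, -⟩) | ⟨rfl, -⟩ | ⟨rfl, -⟩)
      · exact ha.ne rfl
      · exact hb.ne rfl
      · exact ha'.ne rfl
      · exact hb'.ne rfl
    refine SimpleGraph.Connected.mk fun x y =>
      reachable_of_forall_adj_reachable (fun x y hxy => ?_) (hG.1.preconnected x y)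
    by_cases hmem : s(x, y) ∈ ({s(a, b), s(a', b')} : Set (Sym2 V))
    · have hxy' : G.Adj c x ∧ G.Adj c y := by
        simp only [Set.mem_insert_iff, Set.mem_singleton_iff, Sym2.eq_iff] at hmem
        rcases hmem with (⟨rfl, rfl⟩ | ⟨rfl, rfl⟩) | ⟨rfl, rfl⟩ | ⟨rfl, rfl⟩ <;>
          constructor <;> assumption
      exact (hc x hxy'.1).symm.reachable.trans (hc y hxy'.2).reachable
    · exact SimpleGraph.Adj.reachable ((SimpleGraph.deleteEdges_adj ..).2 ⟨hxy, hmem⟩)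
  have h1 := hcon.card_vert_le_card_edgeSet_add_one
  rw [SimpleGraph.edgeSet_deleteEdges, Nat.card_coe_set_eq, Set.ncard_sdiff, Set.ncard_pair hne, hG.2,
    Nat.card_eq_fintype_card] at h1
  · have h2 : 0 < Fintype.card V := Fintype.card_pos_iff.2 ⟨c⟩
    have h3 : 1 < Fintype.card V := Fintype.one_lt_card_iff.2 ⟨_, _, ha.ne⟩
    omega
  · rintro e (rfl | rfl) <;> simpa

open scoped Classical in
theorem IsUnicyclic.card_edgeFinset {V : Type u} [Fintype V] {G : SimpleGraph V}
    (hG : IsUnicyclic G) : G.edgeFinset.card = Fintype.card V := by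
  rw [← hG.2, Set.ncard_eq_toFinset_card']
  rfl

open scoped Classical in
theorem IsUnicyclic.degree_pos {V : Type u} [Fintype V] {G : SimpleGraph V}
    (hG : IsUnicyclic G) (hV : 1 < Fintype.card V) (i : V) : 0 < G.degree i := by
  have := Fintype.one_lt_card_iff_nontrivial.1 hV
  exact hG.1.preconnected.degree_pos_of_nontrivial i

open scoped Classical in
theorem IsUnicyclic.sum_degree {V : Type u} [Fintype V] {G : SimpleGraph V}
    (hG : IsUnicyclic G) : ∑ i, G.degree i = 2 * Fintype.card V := by
  rw [G.sum_degrees_eq_twice_card_edges, hG.card_edgeFinset]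

open scoped Classical in
/-- The sum of the degrees of the neighbours of a vertex. -/
noncomputable def nbrSum {V : Type u} [Fintype V] (G : SimpleGraph V) (i : V) : ℕ :=
  ∑ j ∈ G.neighborFinset i, G.degree j

-- Double counting of pairs `(j, e)` with `j` a neighbour of `i` and `e` an edge at `j`.
open scoped Classical in
theorem nbrSum_eq_sum_edges {V : Type u} [Fintype V] (G : SimpleGraph V) (i : V) :
    nbrSum G i = ∑ e ∈ G.edgeFinset, {j ∈ G.neighborFinset i | j ∈ e}.card := by
  refine Eq.trans ?_ (Finset.sum_card_bipartiteAbove_eq_sum_card_bipartiteBelow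
    (fun (j : V) (e : Sym2 V) => j ∈ e))
  rw [nbrSum]
  refine Finset.sum_congr rfl fun j _ => ?_
  rw [← G.card_incidenceFinset_eq_degree, SimpleGraph.incidenceFinset_eq_filter]
  rfl

-- An edge contributes as many units as it has ends among the neighbours of `i`. It contributes two
-- only if it closes a triangle at `i`, which happens for at most one of the `n` edges. This bound
-- drives the estimates for the graphs outside the four extremal families.
open scoped Classical in
theorem IsUnicyclic.nbrSum_le {V : Type u} [Fintype V] {G : SimpleGraph V}
    (hG : IsUnicyclic G) (i : V) : nbrSum G i ≤ Fintype.card V + 1 := by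
  have h1 : {e ∈ G.edgeFinset | ∀ j ∈ e, G.Adj i j}.card ≤ 1 := by
    refine Finset.card_le_one.2 fun e he f hf => ?_
    rw [Finset.mem_filter, SimpleGraph.mem_edgeFinset] at he hf
    induction e with | _ a b
    induction f with | _ a' b'
    simp only [Sym2.mem_iff, forall_eq_or_imp, forall_eq, SimpleGraph.mem_edgeSet] at he hf
    exact hG.edge_unique_of_subset_neighborSet he.2.1 he.2.2 he.1 hf.2.1 hf.2.2 hf.1
  calc nbrSum G i = ∑ e ∈ G.edgeFinset, {j ∈ G.neighborFinset i | j ∈ e}.card :=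
        nbrSum_eq_sum_edges G i
    _ ≤ ∑ e ∈ G.edgeFinset, (1 + if ∀ j ∈ e, G.Adj i j then 1 else 0) := by
        refine Finset.sum_le_sum fun e _ => ?_
        induction e with | _ a b
        split_ifs with h
        · calc _ ≤ ({a, b} : Finset V).card := Finset.card_le_card fun j hj => by
                simpa using (Finset.mem_filter.1 hj).2
            _ ≤ 2 := Finset.card_le_two
        · rw [add_zero]
          refine Finset.card_le_one.2 fun x hx y hy => ?_
          simp only [Finset.mem_filter, SimpleGraph.mem_neighborFinset, Sym2.mem_iff] at hx hy
          simp only [Sym2.mem_iff, forall_eq_or_imp, forall_eq] at h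
          by_contra hne
          rcases hx with ⟨hx, rfl | rfl⟩ <;> rcases hy with ⟨hy, rfl | rfl⟩ <;> simp_all
    _ ≤ Fintype.card V + 1 := by
        rw [Finset.sum_add_distrib, ← Finset.card_filter, Finset.sum_const, smul_eq_mul, mul_one,
          hG.card_edgeFinset]
        omega

open scoped Classical in
theorem IsUnicyclic.card_edges_not_mem {V : Type u} [Fintype V] {G : SimpleGraph V}
    (hG : IsUnicyclic G) (c : V) :
    {e ∈ G.edgeFinset | c ∉ e}.card + G.degree c = Fintype.card V := by
  rw [← hG.card_edgeFinset, ← G.card_incidenceFinset_eq_degree,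
    SimpleGraph.incidenceFinset_eq_filter, add_comm]
  exact Finset.card_filter_add_card_filter_not _

open scoped Classical in
/-- Two distinct vertices are incident with `d x + d y` or `d x + d y - 1` edges. -/
theorem IsUnicyclic.degree_add_degree {V : Type u} [Fintype V] {G : SimpleGraph V}
    (hG : IsUnicyclic G) {x y : V} (hxy : x ≠ y) :
    G.degree x + G.degree y + {e ∈ G.edgeFinset | x ∉ e ∧ y ∉ e}.card
      = Fintype.card V + if G.Adj x y then 1 else 0 := by
  have h1 : G.degree x + G.degree y = (G.incidenceFinset x ∪ G.incidenceFinset y).card +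
      (G.incidenceFinset x ∩ G.incidenceFinset y).card := by
    rw [Finset.card_union_add_card_inter, G.card_incidenceFinset_eq_degree,
      G.card_incidenceFinset_eq_degree]
  have h2 : (G.incidenceFinset x ∩ G.incidenceFinset y).card = if G.Adj x y then 1 else 0 := by
    split_ifs with h
    · have : G.incidenceFinset x ∩ G.incidenceFinset y = {s(x, y)} := by
        ext e
        simp only [SimpleGraph.incidenceFinset_eq_filter, Finset.mem_inter, Finset.mem_filter,
          SimpleGraph.mem_edgeFinset, Finset.mem_singleton]
        constructor
        · rintro ⟨⟨-, hx⟩, -, hy⟩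
          exact (Sym2.mem_and_mem_iff hxy).1 ⟨hx, hy⟩
        · rintro rfl
          simp [h]
      rw [this, Finset.card_singleton]
    · rw [Finset.card_eq_zero, Finset.eq_empty_iff_forall_notMem]
      intro e he
      simp only [SimpleGraph.incidenceFinset_eq_filter, Finset.mem_inter, Finset.mem_filter,
          SimpleGraph.mem_edgeFinset] at he
      have := (Sym2.mem_and_mem_iff hxy).1 ⟨he.1.2, he.2.2⟩
      rw [this] at he
      exact h he.1.1
  have h3 : (G.incidenceFinset x ∪ G.incidenceFinset y).card +
      {e ∈ G.edgeFinset | x ∉ e ∧ y ∉ e}.card = Fintype.card V := by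
    rw [← hG.card_edgeFinset, ← Finset.card_filter_add_card_filter_not (s := G.edgeFinset)
      (fun e => x ∈ e ∨ y ∈ e)]
    congr 2
    · simp only [SimpleGraph.incidenceFinset_eq_filter, Finset.filter_or]
    · simp only [not_or]
  omega

/-! ### The four extremal graphs, and weights solving every row except the centre. -/

/-- `G` is a star with centre `c` together with an edge joining the leaves `a` and `b`. -/
structure IsStarPlusEdge {V : Type u} (G : SimpleGraph V) (c a b : V) : Prop where
  ca : c ≠ a
  cb : c ≠ b
  ab : a ≠ b
  adj : ∀ x y, G.Adj x y ↔ (x = c ∧ y ≠ c) ∨ (y = c ∧ x ≠ c) ∨ (x = a ∧ y = b) ∨ (x = b ∧ y = a)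

/-- `G` is a quadrangle `c - p - o - q - c` with all other vertices attached to `c`. -/
structure IsQuadrangleStar {V : Type u} (G : SimpleGraph V) (c p q o : V) : Prop where
  cp : c ≠ p
  cq : c ≠ q
  co : c ≠ o
  pq : p ≠ q
  po : p ≠ o
  qo : q ≠ o
  adj : ∀ x y, G.Adj x y ↔ (x = c ∧ y ≠ c ∧ y ≠ o) ∨ (y = c ∧ x ≠ c ∧ x ≠ o) ∨
    (x = o ∧ (y = p ∨ y = q)) ∨ (y = o ∧ (x = p ∨ x = q))

/-- `G` is a triangle `c - p - q - c` with the vertex `w` attached to `p` and all other vertices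
attached to `c`. -/
structure IsTriangleAttached {V : Type u} (G : SimpleGraph V) (c p q w : V) : Prop where
  cp : c ≠ p
  cq : c ≠ q
  cw : c ≠ w
  pq : p ≠ q
  pw : p ≠ w
  qw : q ≠ w
  adj : ∀ x y, G.Adj x y ↔ (x = c ∧ y ≠ c ∧ y ≠ w) ∨ (y = c ∧ x ≠ c ∧ x ≠ w) ∨
    (x = p ∧ y = q) ∨ (x = q ∧ y = p) ∨ (x = p ∧ y = w) ∨ (x = w ∧ y = p)

/-- `G` is a triangle `c - a - b - c` with the path `c - s - w` and all other vertices attached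
to `c`. -/
structure IsTrianglePath {V : Type u} (G : SimpleGraph V) (c a b s w : V) : Prop where
  ca : c ≠ a
  cb : c ≠ b
  cs : c ≠ s
  cw : c ≠ w
  ab : a ≠ b
  as : a ≠ s
  aw : a ≠ w
  bs : b ≠ s
  bw : b ≠ w
  sw : s ≠ w
  adj : ∀ x y, G.Adj x y ↔ (x = c ∧ y ≠ c ∧ y ≠ w) ∨ (y = c ∧ x ≠ c ∧ x ≠ w) ∨
    (x = a ∧ y = b) ∨ (x = b ∧ y = a) ∨ (x = s ∧ y = w) ∨ (x = w ∧ y = s)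

open scoped Classical in
theorem agRow_eq_of_neighborFinset {V : Type u} [Fintype V] {G : SimpleGraph V} {i : V}
    {s : Finset V} (h : G.neighborFinset i = s) (z : V → ℝ) :
    agRow G z i = ∑ j ∈ s, ((s.card : ℝ) + G.degree j) * z j := by
  rw [agRow, h, ← G.card_neighborFinset_eq_degree, h]

open scoped Classical in
theorem degree_eq_of_neighborFinset {V : Type u} [Fintype V] {G : SimpleGraph V} {i : V}
    {s : Finset V} (h : G.neighborFinset i = s) : G.degree i = s.card := by
  rw [← G.card_neighborFinset_eq_degree, h]

open scoped Classical in
theorem sum_eq_card_sdiff_mul {V : Type u} [Fintype V] (s : Finset V) {f : V → ℝ} {r : ℝ}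
    (h : ∀ j ∉ s, f j = r) :
    ∑ j ∈ Finset.univ \ s, f j = ((Fintype.card V : ℝ) - s.card) * r := by
  rw [Finset.sum_congr rfl fun j hj => h j (Finset.mem_sdiff.1 hj).2, Finset.sum_const,
    nsmul_eq_mul, ← Finset.compl_eq_univ_sdiff, Finset.card_compl,
    Nat.cast_sub (Finset.card_le_univ s)]

-- With `z c = 1`, the leaf equation `R z = D + 1` and the equation `2 R z = (D + 2) + 4 z` shared
-- by `a` and `b` determine the weights, and `4 ≤ R` keeps the denominators positive. What remains
-- is the centre row as a rational function of `R`, to be compared with `R * D`.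
open scoped Classical in
theorem IsStarPlusEdge.exists_weights {V : Type u} [Fintype V] {G : SimpleGraph V} {c a b : V}
    (h : IsStarPlusEdge G c a b) {D R : ℝ} (hD : (Fintype.card V : ℝ) - 1 = D) (hR : 4 ≤ R) :
    (∀ i, 0 < G.degree i) ∧ (G.degree c : ℝ) = D ∧ ∃ z : V → ℝ, (∀ i, 0 < z i) ∧ z c = 1 ∧
      (∀ i, i ≠ c → agRow G z i = R * (G.degree i * z i)) ∧
      agRow G z c = (D - 2) * (D + 1) ^ 2 / R + (D + 2) ^ 2 / (R - 2) := by
  obtain ⟨ca, cb, ab, adj⟩ := h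
  have hcard : ({c, a, b} : Finset V).card = 3 := Finset.card_eq_three.2 ⟨c, a, b, ca, cb, ab, rfl⟩
  have hV : 3 ≤ Fintype.card V := hcard ▸ Finset.card_le_univ _
  have hV' : (3 : ℝ) ≤ Fintype.card V := by exact_mod_cast hV
  have Nc : G.neighborFinset c = insert a (insert b (Finset.univ \ {c, a, b})) := by
    ext j; simp only [SimpleGraph.mem_neighborFinset, adj]; grind
  have Na : G.neighborFinset a = {c, b} := by
    ext j; simp only [SimpleGraph.mem_neighborFinset, adj]; grind
  have Nb : G.neighborFinset b = {c, a} := by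
    ext j; simp only [SimpleGraph.mem_neighborFinset, adj]; grind
  have Nl : ∀ j, j ∉ ({c, a, b} : Finset V) → G.neighborFinset j = {c} := by
    intro i hi; ext j; simp only [SimpleGraph.mem_neighborFinset, adj]; grind
  have hc : (G.degree c : ℝ) = D := by
    have : G.neighborFinset c = Finset.univ \ {c} := by
      ext j; simp only [SimpleGraph.mem_neighborFinset, adj]; grind
    rw [degree_eq_of_neighborFinset this, ← Finset.compl_eq_univ_sdiff, Finset.card_compl,
      Finset.card_singleton, Nat.cast_sub (by omega), ← hD, Nat.cast_one]
  have ha : G.degree a = 2 := by rw [degree_eq_of_neighborFinset Na, Finset.card_pair cb]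
  have hb : G.degree b = 2 := by rw [degree_eq_of_neighborFinset Nb, Finset.card_pair ca]
  have hl : ∀ j, j ∉ ({c, a, b} : Finset V) → G.degree j = 1 := fun j hj => by
    rw [degree_eq_of_neighborFinset (Nl j hj), Finset.card_singleton]
  have hD2 : 2 ≤ D := by linarith
  have hR0 : 0 < R - 2 := by linarith
  let z : V → ℝ := fun j => if j = c then 1 else if j ∈ ({c, a, b} : Finset V) then
    (D + 2) / (2 * (R - 2)) else (D + 1) / R
  have zc : z c = 1 := by simp [z]
  have za : z a = (D + 2) / (2 * (R - 2)) := by simp [z, ca.symm]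
  have zb : z b = (D + 2) / (2 * (R - 2)) := by simp [z, cb.symm]
  have zl : ∀ j, j ∉ ({c, a, b} : Finset V) → z j = (D + 1) / R := by
    intro j hj
    have : j ≠ c := by rintro rfl; simp at hj
    simp only [z, if_neg this, if_neg hj]
  have cases : ∀ P : V → Prop, P c → P a → P b → (∀ j, j ∉ ({c, a, b} : Finset V) → P j) →
      ∀ i, P i := by
    intro P hc ha hb hl i
    by_cases hi : i ∈ ({c, a, b} : Finset V)
    · simp only [Finset.mem_insert, Finset.mem_singleton] at hi
      rcases hi with rfl | rfl | rfl <;> assumption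
    · exact hl i hi
  refine ⟨?_, hc, z, ?_, zc, ?_, ?_⟩
  · refine cases _ ?_ (by omega) (by omega) (fun j hj => by rw [hl j hj]; omega)
    have : (0 : ℝ) < G.degree c := by rw [hc]; linarith
    exact_mod_cast this
  · refine cases _ (by rw [zc]; norm_num) (by rw [za]; positivity) (by rw [zb]; positivity)
      (fun j hj => by rw [zl j hj]; positivity)
  · refine cases _ (fun h => absurd rfl h) (fun _ => ?_) (fun _ => ?_) (fun j hj _ => ?_)
    · rw [agRow_eq_of_neighborFinset Na, Finset.sum_pair cb, Finset.card_pair cb, ha, hb, hc, zc,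
        za, zb]
      push_cast
      field_simp
      ring
    · rw [agRow_eq_of_neighborFinset Nb, Finset.sum_pair ca, Finset.card_pair ca, ha, hb, hc, zc,
        za, zb]
      push_cast
      field_simp
      ring
    · rw [agRow_eq_of_neighborFinset (Nl j hj), Finset.sum_singleton, Finset.card_singleton,
        hl j hj, hc, zc, zl j hj]
      push_cast
      field_simp
      ring
  · rw [agRow, Nc, Finset.sum_insert (by simp [ab]), Finset.sum_insert (by simp),
      sum_eq_card_sdiff_mul (r := (D + 1) * ((D + 1) / R)) _ (fun j hj => by
        rw [hl j hj, hc, zl j hj, Nat.cast_one]), hcard, hc, ha, hb, za, zb,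
      show (Fintype.card V : ℝ) = D + 1 by linarith]
    push_cast
    field_simp
    ring

open scoped Classical in
theorem IsQuadrangleStar.exists_weights {V : Type u} [Fintype V] {G : SimpleGraph V} {c p q o : V}
    (h : IsQuadrangleStar G c p q o) {D R : ℝ} (hD : (Fintype.card V : ℝ) - 2 = D) (hR : 4 ≤ R) :
    (∀ i, 0 < G.degree i) ∧ (G.degree c : ℝ) = D ∧ ∃ z : V → ℝ, (∀ i, 0 < z i) ∧ z c = 1 ∧
      (∀ i, i ≠ c → agRow G z i = R * (G.degree i * z i)) ∧
      agRow G z c = (D - 2) * (D + 1) ^ 2 / R + (D + 2) ^ 2 * R / (R ^ 2 - 8) := by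
  obtain ⟨cp, cq, co, pq, po, qo, adj⟩ := h
  have hcard : ({c, p, q, o} : Finset V).card = 4 := by
    rw [Finset.card_insert_of_notMem (by simp [cp, cq, co]),
      Finset.card_eq_three.2 ⟨p, q, o, pq, po, qo, rfl⟩]
  have hV : 4 ≤ Fintype.card V := hcard ▸ Finset.card_le_univ _
  have hV' : (4 : ℝ) ≤ Fintype.card V := by exact_mod_cast hV
  have Nc : G.neighborFinset c = insert p (insert q (Finset.univ \ {c, p, q, o})) := by
    ext j; simp only [SimpleGraph.mem_neighborFinset, adj]; grind
  have Np : G.neighborFinset p = {c, o} := by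
    ext j; simp only [SimpleGraph.mem_neighborFinset, adj]; grind
  have Nq : G.neighborFinset q = {c, o} := by
    ext j; simp only [SimpleGraph.mem_neighborFinset, adj]; grind
  have No : G.neighborFinset o = {p, q} := by
    ext j; simp only [SimpleGraph.mem_neighborFinset, adj]; grind
  have Nl : ∀ j, j ∉ ({c, p, q, o} : Finset V) → G.neighborFinset j = {c} := by
    intro i hi; ext j; simp only [SimpleGraph.mem_neighborFinset, adj]; grind
  have hc : (G.degree c : ℝ) = D := by
    have : G.neighborFinset c = Finset.univ \ {c, o} := by
      ext j; simp only [SimpleGraph.mem_neighborFinset, adj]; grind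
    rw [degree_eq_of_neighborFinset this, ← Finset.compl_eq_univ_sdiff, Finset.card_compl,
      Finset.card_pair co, Nat.cast_sub (by omega), ← hD, Nat.cast_ofNat]
  have hp : G.degree p = 2 := by rw [degree_eq_of_neighborFinset Np, Finset.card_pair co]
  have hq : G.degree q = 2 := by rw [degree_eq_of_neighborFinset Nq, Finset.card_pair co]
  have ho : G.degree o = 2 := by rw [degree_eq_of_neighborFinset No, Finset.card_pair pq]
  have hl : ∀ j, j ∉ ({c, p, q, o} : Finset V) → G.degree j = 1 := fun j hj => by
    rw [degree_eq_of_neighborFinset (Nl j hj), Finset.card_singleton]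
  have hD2 : 2 ≤ D := by linarith
  have hR0 : 0 < R := by linarith
  have hR1 : 0 < R ^ 2 - 8 := by nlinarith
  -- The equation at `o` is `2 R z_o = 8 z_p` by symmetry in `p` and `q`; inserting it into `2 R z_p
  -- = (D + 2) + 4 z_o` yields the denominator `R ^ 2 - 8`.
  let z : V → ℝ := fun j => if j = c then 1 else if j = o then 2 * (D + 2) / (R ^ 2 - 8) else
    if j ∈ ({c, p, q, o} : Finset V) then (D + 2) * R / (2 * (R ^ 2 - 8)) else (D + 1) / R
  have zc : z c = 1 := by simp [z]
  have zo : z o = 2 * (D + 2) / (R ^ 2 - 8) := by simp [z, co.symm]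
  have zp : z p = (D + 2) * R / (2 * (R ^ 2 - 8)) := by simp [z, cp.symm, po]
  have zq : z q = (D + 2) * R / (2 * (R ^ 2 - 8)) := by simp [z, cq.symm, qo]
  have zl : ∀ j, j ∉ ({c, p, q, o} : Finset V) → z j = (D + 1) / R := by
    intro j hj
    have h1 : j ≠ c := by rintro rfl; simp at hj
    have h2 : j ≠ o := by rintro rfl; simp at hj
    simp only [z, if_neg h1, if_neg h2, if_neg hj]
  have cases : ∀ P : V → Prop, P c → P p → P q → P o →
      (∀ j, j ∉ ({c, p, q, o} : Finset V) → P j) → ∀ i, P i := by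
    intro P hc hp hq ho hl i
    by_cases hi : i ∈ ({c, p, q, o} : Finset V)
    · simp only [Finset.mem_insert, Finset.mem_singleton] at hi
      rcases hi with rfl | rfl | rfl | rfl <;> assumption
    · exact hl i hi
  refine ⟨?_, hc, z, ?_, zc, ?_, ?_⟩
  · refine cases _ ?_ (by omega) (by omega) (by omega) (fun j hj => by rw [hl j hj]; omega)
    have : (0 : ℝ) < G.degree c := by rw [hc]; linarith
    exact_mod_cast this
  · refine cases _ (by rw [zc]; norm_num) (by rw [zp]; positivity) (by rw [zq]; positivity)
      (by rw [zo]; positivity) (fun j hj => by rw [zl j hj]; positivity)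
  · refine cases _ (fun h => absurd rfl h) (fun _ => ?_) (fun _ => ?_) (fun _ => ?_)
      (fun j hj _ => ?_)
    · rw [agRow_eq_of_neighborFinset Np, Finset.sum_pair co, Finset.card_pair co, hp, ho, hc, zc,
        zp, zo]
      push_cast
      field_simp
      ring
    · rw [agRow_eq_of_neighborFinset Nq, Finset.sum_pair co, Finset.card_pair co, hq, ho, hc, zc,
        zq, zo]
      push_cast
      field_simp
      ring
    · rw [agRow_eq_of_neighborFinset No, Finset.sum_pair pq, Finset.card_pair pq, hp, hq, ho,
        zp, zq, zo]
      push_cast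
      field_simp
      ring
    · rw [agRow_eq_of_neighborFinset (Nl j hj), Finset.sum_singleton, Finset.card_singleton,
        hl j hj, hc, zc, zl j hj]
      push_cast
      field_simp
      ring
  · rw [agRow, Nc, Finset.sum_insert (by simp [pq]), Finset.sum_insert (by simp),
      sum_eq_card_sdiff_mul (r := (D + 1) * ((D + 1) / R)) _ (fun j hj => by
        rw [hl j hj, hc, zl j hj, Nat.cast_one]), hcard, hc, hp, hq, zp, zq,
      show (Fintype.card V : ℝ) = D + 2 by linarith]
    push_cast
    field_simp
    ring

open scoped Classical in
theorem IsTriangleAttached.exists_weights {V : Type u} [Fintype V] {G : SimpleGraph V}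
    {c p q w : V} (h : IsTriangleAttached G c p q w) {D R : ℝ}
    (hD : (Fintype.card V : ℝ) - 2 = D) (hR : 4 ≤ R) :
    (∀ i, 0 < G.degree i) ∧ (G.degree c : ℝ) = D ∧ ∃ z : V → ℝ, (∀ i, 0 < z i) ∧ z c = 1 ∧
      (∀ i, i ≠ c → agRow G z i = R * (G.degree i * z i)) ∧
      agRow G z c = (D - 2) * (D + 1) ^ 2 / R +
        (D + 3) * ((2 * R * (D + 3) + 5 * (D + 2)) / (6 * R ^ 2 - 57)) +
        (D + 2) * (((3 * R - 16 / R) * (D + 2) + 5 * (D + 3)) / (6 * R ^ 2 - 57)) := by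
  obtain ⟨cp, cq, cw, pq, pw, qw, adj⟩ := h
  have hcard : ({c, p, q, w} : Finset V).card = 4 := by
    rw [Finset.card_insert_of_notMem (by simp [cp, cq, cw]),
      Finset.card_eq_three.2 ⟨p, q, w, pq, pw, qw, rfl⟩]
  have hcard' : ({c, q, w} : Finset V).card = 3 := Finset.card_eq_three.2 ⟨c, q, w, cq, cw, qw, rfl⟩
  have hV : 4 ≤ Fintype.card V := hcard ▸ Finset.card_le_univ _
  have hV' : (4 : ℝ) ≤ Fintype.card V := by exact_mod_cast hV
  have Nc : G.neighborFinset c = insert p (insert q (Finset.univ \ {c, p, q, w})) := by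
    ext j; simp only [SimpleGraph.mem_neighborFinset, adj]; grind
  have Np : G.neighborFinset p = {c, q, w} := by
    ext j; simp only [SimpleGraph.mem_neighborFinset, adj]; grind
  have Nq : G.neighborFinset q = {c, p} := by
    ext j; simp only [SimpleGraph.mem_neighborFinset, adj]; grind
  have Nw : G.neighborFinset w = {p} := by
    ext j; simp only [SimpleGraph.mem_neighborFinset, adj]; grind
  have Nl : ∀ j, j ∉ ({c, p, q, w} : Finset V) → G.neighborFinset j = {c} := by
    intro i hi; ext j; simp only [SimpleGraph.mem_neighborFinset, adj]; grind
  have hc : (G.degree c : ℝ) = D := by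
    have : G.neighborFinset c = Finset.univ \ {c, w} := by
      ext j; simp only [SimpleGraph.mem_neighborFinset, adj]; grind
    rw [degree_eq_of_neighborFinset this, ← Finset.compl_eq_univ_sdiff, Finset.card_compl,
      Finset.card_pair cw, Nat.cast_sub (by omega), ← hD, Nat.cast_ofNat]
  have hp : G.degree p = 3 := by rw [degree_eq_of_neighborFinset Np, hcard']
  have hq : G.degree q = 2 := by rw [degree_eq_of_neighborFinset Nq, Finset.card_pair cp]
  have hw : G.degree w = 1 := by rw [degree_eq_of_neighborFinset Nw, Finset.card_singleton]
  have hl : ∀ j, j ∉ ({c, p, q, w} : Finset V) → G.degree j = 1 := fun j hj => by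
    rw [degree_eq_of_neighborFinset (Nl j hj), Finset.card_singleton]
  have hD2 : 2 ≤ D := by linarith
  have hR0 : 0 < R := by linarith
  have hR1 : 0 < 6 * R ^ 2 - 57 := by nlinarith
  obtain ⟨t, ht⟩ : ∃ t, t = (6 * R ^ 2 - 57)⁻¹ := ⟨_, rfl⟩
  have ht1 : t * (6 * R ^ 2 - 57) = 1 := by rw [ht]; exact inv_mul_cancel₀ hR1.ne'
  have hR2 : 0 < 3 * R - 16 / R := by
    rw [sub_pos, div_lt_iff₀ hR0]; nlinarith
  -- Eliminating `w` by `R z_w = 4 z_p` leaves `(3R - 16/R) z_p - 5 z_q = D + 3` and `2R z_q - 5 z_p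
  -- = D + 2`. Cramer's rule applies, with determinant `2R (3R - 16/R) - 25 = 6R² - 57`.
  let z : V → ℝ := fun j => if j = c then 1 else if j = p then
      (2 * R * (D + 3) + 5 * (D + 2)) / (6 * R ^ 2 - 57) else
    if j = q then ((3 * R - 16 / R) * (D + 2) + 5 * (D + 3)) / (6 * R ^ 2 - 57) else
    if j = w then 4 / R * ((2 * R * (D + 3) + 5 * (D + 2)) / (6 * R ^ 2 - 57)) else (D + 1) / R
  have zc : z c = 1 := by simp [z]
  have zp : z p = (2 * R * (D + 3) + 5 * (D + 2)) / (6 * R ^ 2 - 57) := by simp [z, cp.symm]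
  have zq : z q = ((3 * R - 16 / R) * (D + 2) + 5 * (D + 3)) / (6 * R ^ 2 - 57) := by
    simp [z, cq.symm, pq.symm]
  have zw : z w = 4 / R * ((2 * R * (D + 3) + 5 * (D + 2)) / (6 * R ^ 2 - 57)) := by
    simp [z, cw.symm, pw.symm, qw.symm]
  have zl : ∀ j, j ∉ ({c, p, q, w} : Finset V) → z j = (D + 1) / R := by
    intro j hj
    simp only [Finset.mem_insert, Finset.mem_singleton, not_or] at hj
    simp only [z, if_neg hj.1, if_neg hj.2.1, if_neg hj.2.2.1, if_neg hj.2.2.2]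
  have cases : ∀ P : V → Prop, P c → P p → P q → P w →
      (∀ j, j ∉ ({c, p, q, w} : Finset V) → P j) → ∀ i, P i := by
    intro P hc hp hq hw hl i
    by_cases hi : i ∈ ({c, p, q, w} : Finset V)
    · simp only [Finset.mem_insert, Finset.mem_singleton] at hi
      rcases hi with rfl | rfl | rfl | rfl <;> assumption
    · exact hl i hi
  refine ⟨?_, hc, z, ?_, zc, ?_, ?_⟩
  · refine cases _ ?_ (by omega) (by omega) (by omega) (fun j hj => by rw [hl j hj]; omega)
    have : (0 : ℝ) < G.degree c := by rw [hc]; linarith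
    exact_mod_cast this
  · refine cases _ (by rw [zc]; norm_num) (by rw [zp]; positivity) (by rw [zq]; positivity)
      (by rw [zw]; positivity) (fun j hj => by rw [zl j hj]; positivity)
  · refine cases _ (fun h => absurd rfl h) (fun _ => ?_) (fun _ => ?_) (fun _ => ?_)
      (fun j hj _ => ?_)
    · rw [agRow_eq_of_neighborFinset Np, Finset.sum_insert (by simp [cq, cw]), Finset.sum_pair qw,
        hcard', hp, hq, hw, hc, zc, zp, zq, zw,
        div_eq_mul_inv _ (6 * R ^ 2 - 57), div_eq_mul_inv _ (6 * R ^ 2 - 57), ← ht]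
      push_cast
      field_simp
      linear_combination -(D + 3) * R * ht1
    · rw [agRow_eq_of_neighborFinset Nq, Finset.sum_pair cp, Finset.card_pair cp, hq, hp, hc, zc,
        zq, zp, div_eq_mul_inv _ (6 * R ^ 2 - 57), div_eq_mul_inv _ (6 * R ^ 2 - 57), ← ht]
      push_cast
      field_simp
      linear_combination -(D + 2) * ht1
    · rw [agRow_eq_of_neighborFinset Nw, Finset.sum_singleton, Finset.card_singleton, hp, hw,
        zp, zw]
      push_cast
      field_simp
      ring
    · rw [agRow_eq_of_neighborFinset (Nl j hj), Finset.sum_singleton, Finset.card_singleton,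
        hl j hj, hc, zc, zl j hj]
      push_cast
      field_simp
      ring
  · rw [agRow, Nc, Finset.sum_insert (by simp [pq]), Finset.sum_insert (by simp),
      sum_eq_card_sdiff_mul (r := (D + 1) * ((D + 1) / R)) _ (fun j hj => by
        rw [hl j hj, hc, zl j hj, Nat.cast_one]), hcard, hc, hp, hq, zp, zq,
      show (Fintype.card V : ℝ) = D + 2 by linarith]
    push_cast
    ring

open scoped Classical in
theorem IsTrianglePath.exists_weights {V : Type u} [Fintype V] {G : SimpleGraph V}
    {c a b s w : V} (h : IsTrianglePath G c a b s w) {D R : ℝ}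
    (hD : (Fintype.card V : ℝ) - 2 = D) (hR : 4 ≤ R) :
    (∀ i, 0 < G.degree i) ∧ (G.degree c : ℝ) = D ∧ ∃ z : V → ℝ, (∀ i, 0 < z i) ∧ z c = 1 ∧
      (∀ i, i ≠ c → agRow G z i = R * (G.degree i * z i)) ∧
      agRow G z c = (D - 3) * (D + 1) ^ 2 / R + (D + 2) ^ 2 / (R - 2) +
        (D + 2) ^ 2 * R / (2 * R ^ 2 - 9) := by
  obtain ⟨ca, cb, cs, cw, ab, as, aw, bs, bw, sw, adj⟩ := h
  have hcard : ({c, a, b, s, w} : Finset V).card = 5 := by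
    rw [Finset.card_insert_of_notMem (by simp [ca, cb, cs, cw]),
      Finset.card_insert_of_notMem (by simp [ab, as, aw]),
      Finset.card_eq_three.2 ⟨b, s, w, bs, bw, sw, rfl⟩]
  have hV : 5 ≤ Fintype.card V := hcard ▸ Finset.card_le_univ _
  have hV' : (5 : ℝ) ≤ Fintype.card V := by exact_mod_cast hV
  have Nc : G.neighborFinset c =
      insert a (insert b (insert s (Finset.univ \ {c, a, b, s, w}))) := by
    ext j
    simp only [SimpleGraph.mem_neighborFinset, adj, Finset.mem_insert, Finset.mem_sdiff,
      Finset.mem_univ, Finset.mem_singleton]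
    grind
  have Na : G.neighborFinset a = {c, b} := by
    ext j; simp only [SimpleGraph.mem_neighborFinset, adj]; grind
  have Nb : G.neighborFinset b = {c, a} := by
    ext j; simp only [SimpleGraph.mem_neighborFinset, adj]; grind
  have Ns : G.neighborFinset s = {c, w} := by
    ext j; simp only [SimpleGraph.mem_neighborFinset, adj]; grind
  have Nw : G.neighborFinset w = {s} := by
    ext j; simp only [SimpleGraph.mem_neighborFinset, adj]; grind
  have Nl : ∀ j, j ∉ ({c, a, b, s, w} : Finset V) → G.neighborFinset j = {c} := by
    intro i hi; ext j; simp only [SimpleGraph.mem_neighborFinset, adj]; grind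
  have hc : (G.degree c : ℝ) = D := by
    have : G.neighborFinset c = Finset.univ \ {c, w} := by
      ext j; simp only [SimpleGraph.mem_neighborFinset, adj]; grind
    rw [degree_eq_of_neighborFinset this, ← Finset.compl_eq_univ_sdiff, Finset.card_compl,
      Finset.card_pair cw, Nat.cast_sub (by omega), ← hD, Nat.cast_ofNat]
  have ha : G.degree a = 2 := by rw [degree_eq_of_neighborFinset Na, Finset.card_pair cb]
  have hb : G.degree b = 2 := by rw [degree_eq_of_neighborFinset Nb, Finset.card_pair ca]
  have hs : G.degree s = 2 := by rw [degree_eq_of_neighborFinset Ns, Finset.card_pair cw]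
  have hw : G.degree w = 1 := by rw [degree_eq_of_neighborFinset Nw, Finset.card_singleton]
  have hl : ∀ j, j ∉ ({c, a, b, s, w} : Finset V) → G.degree j = 1 := fun j hj => by
    rw [degree_eq_of_neighborFinset (Nl j hj), Finset.card_singleton]
  have hD2 : 3 ≤ D := by linarith
  have hR0 : 0 < R := by linarith
  have hR1 : 0 < 2 * R ^ 2 - 9 := by nlinarith
  have hR2 : 0 < R - 2 := by linarith
  -- On the path, `R z_w = 3 z_s` turns `2 R z_s = (D + 2) + 3 z_w` into `(2R - 9/R) z_s = D + 2`;
  -- the triangle vertices `a`, `b` are weighted as in `IsStarPlusEdge.exists_weights`.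
  let z : V → ℝ := fun j => if j = c then 1 else if j = s then
      (D + 2) * R / (2 * R ^ 2 - 9) else
    if j = w then 3 * (D + 2) / (2 * R ^ 2 - 9) else
    if j ∈ ({c, a, b, s, w} : Finset V) then (D + 2) / (2 * (R - 2)) else (D + 1) / R
  have zc : z c = 1 := by simp [z]
  have zs : z s = (D + 2) * R / (2 * R ^ 2 - 9) := by simp [z, cs.symm]
  have zw : z w = 3 * (D + 2) / (2 * R ^ 2 - 9) := by simp [z, cw.symm, sw.symm]
  have za : z a = (D + 2) / (2 * (R - 2)) := by simp [z, ca.symm, as, aw]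
  have zb : z b = (D + 2) / (2 * (R - 2)) := by simp [z, cb.symm, bs, bw]
  have zl : ∀ j, j ∉ ({c, a, b, s, w} : Finset V) → z j = (D + 1) / R := by
    intro j hj
    have hj' := hj
    simp only [Finset.mem_insert, Finset.mem_singleton, not_or] at hj'
    simp only [z, if_neg hj, if_neg hj'.1, if_neg hj'.2.2.2.1, if_neg hj'.2.2.2.2]
  have cases : ∀ P : V → Prop, P c → P a → P b → P s → P w →
      (∀ j, j ∉ ({c, a, b, s, w} : Finset V) → P j) → ∀ i, P i := by
    intro P hc ha hb hs hw hl i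
    by_cases hi : i ∈ ({c, a, b, s, w} : Finset V)
    · simp only [Finset.mem_insert, Finset.mem_singleton] at hi
      rcases hi with rfl | rfl | rfl | rfl | rfl <;> assumption
    · exact hl i hi
  refine ⟨?_, hc, z, ?_, zc, ?_, ?_⟩
  · refine cases _ ?_ (by omega) (by omega) (by omega) (by omega)
      (fun j hj => by rw [hl j hj]; omega)
    have : (0 : ℝ) < G.degree c := by rw [hc]; linarith
    exact_mod_cast this
  · refine cases _ (by rw [zc]; norm_num) (by rw [za]; positivity) (by rw [zb]; positivity)
      (by rw [zs]; positivity) (by rw [zw]; positivity) (fun j hj => by rw [zl j hj]; positivity)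
  · refine cases _ (fun h => absurd rfl h) (fun _ => ?_) (fun _ => ?_) (fun _ => ?_) (fun _ => ?_)
      (fun j hj _ => ?_)
    · rw [agRow_eq_of_neighborFinset Na, Finset.sum_pair cb, Finset.card_pair cb, ha, hb, hc, zc,
        za, zb]
      push_cast
      field_simp
      ring
    · rw [agRow_eq_of_neighborFinset Nb, Finset.sum_pair ca, Finset.card_pair ca, ha, hb, hc, zc,
        za, zb]
      push_cast
      field_simp
      ring
    · rw [agRow_eq_of_neighborFinset Ns, Finset.sum_pair cw, Finset.card_pair cw, hs, hw, hc, zc,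
        zs, zw]
      push_cast
      field_simp
      ring
    · rw [agRow_eq_of_neighborFinset Nw, Finset.sum_singleton, Finset.card_singleton, hs, hw,
        zs, zw]
      push_cast
      field_simp
      ring
    · rw [agRow_eq_of_neighborFinset (Nl j hj), Finset.sum_singleton, Finset.card_singleton,
        hl j hj, hc, zc, zl j hj]
      push_cast
      field_simp
      ring
  · rw [agRow, Nc, Finset.sum_insert (by simp [ab, as]), Finset.sum_insert (by simp [bs]),
      Finset.sum_insert (by simp),
      sum_eq_card_sdiff_mul (r := (D + 1) * ((D + 1) / R)) _ (fun j hj => by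
        rw [hl j hj, hc, zl j hj, Nat.cast_one]), hcard, hc, ha, hb, hs, za, zb, zs,
      show (Fintype.card V : ℝ) = D + 2 by linarith]
    push_cast
    field_simp
    ring

-- Since all other rows are equalities, the centre row alone places the spectral radius relative to
-- `R/2`; the companion lemma treats the opposite strict inequality.
open scoped Classical in
theorem agSpectralRadius_le_of_weights {V : Type u} [Fintype V] {G : SimpleGraph V} {c : V}
    {D R P : ℝ}
    (h : (∀ i, 0 < G.degree i) ∧ (G.degree c : ℝ) = D ∧ ∃ z : V → ℝ, (∀ i, 0 < z i) ∧ z c = 1 ∧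
      (∀ i, i ≠ c → agRow G z i = R * (G.degree i * z i)) ∧ agRow G z c = P)
    (hP : P ≤ R * D) : agSpectralRadius G ≤ R / 2 := by
  obtain ⟨hd, hc, z, hz, zc, hrow, hrowc⟩ := h
  have : Nonempty V := ⟨c⟩
  refine agSpectralRadius_le_of_agRow_le G hd hz fun i => ?_
  by_cases hi : i = c
  · rw [hi, hrowc, hc, zc, mul_one]; exact hP
  · exact (hrow i hi).le

open scoped Classical in
theorem lt_agSpectralRadius_of_weights {V : Type u} [Fintype V] {G : SimpleGraph V} {c : V}
    {D R P : ℝ}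
    (h : (∀ i, 0 < G.degree i) ∧ (G.degree c : ℝ) = D ∧ ∃ z : V → ℝ, (∀ i, 0 < z i) ∧ z c = 1 ∧
      (∀ i, i ≠ c → agRow G z i = R * (G.degree i * z i)) ∧ agRow G z c = P)
    (hP : R * D < P) : R / 2 < agSpectralRadius G := by
  obtain ⟨hd, hc, z, hz, zc, hrow, hrowc⟩ := h
  have : Nonempty V := ⟨c⟩
  have hlt : R * (G.degree c * z c) < agRow G z c := by rwa [hrowc, hc, zc, mul_one]
  refine lt_agSpectralRadius_of_le_agRow G hd hz (fun i => ?_) hlt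
  by_cases hi : i = c
  · rw [hi]; exact hlt.le
  · exact (hrow i hi).ge

/-! ### Isomorphism, unicyclicity and recognition of the extremal graphs. -/

/-- In each family the unnamed vertices are interchangeable leaves at the centre, so any bijection
matching the named vertices is an isomorphism. Only the extension of a partial injection is needed.
-/
theorem exists_equiv_eqOn_of_card_eq {V : Type u} {W : Type v} [Fintype V] [Fintype W]
    (hVW : Fintype.card V = Fintype.card W) (s : Finset V) {f : V → W} (hf : Set.InjOn f s) :
    ∃ σ : V ≃ W, ∀ x ∈ s, σ x = f x := by
  classical
  obtain ⟨g, hg⟩ := Finset.exists_equiv_extend_of_card_eq (t := (Finset.univ : Finset W))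
    (s := s) (f := f) (by rw [hVW, Finset.card_univ]) (Finset.subset_univ _) hf
  refine ⟨g.trans (Equiv.subtypeUnivEquiv Finset.mem_univ), fun x hx => ?_⟩
  simpa using hg x hx

open scoped Classical in
theorem IsStarPlusEdge.nonempty_iso {V : Type u} {W : Type v} [Fintype V] [Fintype W]
    {G : SimpleGraph V} {H : SimpleGraph W} {c a b : V} {c' a' b' : W}
    (h : IsStarPlusEdge G c a b) (h' : IsStarPlusEdge H c' a' b')
    (hVW : Fintype.card V = Fintype.card W) : Nonempty (G ≃g H) := by
  obtain ⟨ca, cb, ab, adj⟩ := h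
  obtain ⟨ca', cb', ab', adj'⟩ := h'
  obtain ⟨σ, hσ⟩ := exists_equiv_eqOn_of_card_eq hVW {c, a, b}
    (f := fun x => if x = c then c' else if x = a then a' else b') (by
      intro x hx y hy hxy
      simp only [Finset.coe_insert, Finset.coe_singleton, Set.mem_insert_iff,
        Set.mem_singleton_iff] at hx hy
      grind)
  have hc : ∀ x, σ x = c' ↔ x = c := fun x => by
    rw [show c' = σ c by rw [hσ c (by simp)]; simp, σ.apply_eq_iff_eq]
  have ha : ∀ x, σ x = a' ↔ x = a := fun x => by
    rw [show a' = σ a by rw [hσ a (by simp)]; simp [ca.symm], σ.apply_eq_iff_eq]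
  have hb : ∀ x, σ x = b' ↔ x = b := fun x => by
    rw [show b' = σ b by rw [hσ b (by simp)]; simp [cb.symm, ab.symm], σ.apply_eq_iff_eq]
  exact ⟨σ, fun {x y} => by simp only [adj, adj', ne_eq, hc, ha, hb]⟩

open scoped Classical in
theorem IsQuadrangleStar.nonempty_iso {V : Type u} {W : Type v} [Fintype V] [Fintype W]
    {G : SimpleGraph V} {H : SimpleGraph W} {c p q o : V} {c' p' q' o' : W}
    (h : IsQuadrangleStar G c p q o) (h' : IsQuadrangleStar H c' p' q' o')
    (hVW : Fintype.card V = Fintype.card W) : Nonempty (G ≃g H) := by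
  obtain ⟨cp, cq, co, pq, po, qo, adj⟩ := h
  obtain ⟨cp', cq', co', pq', po', qo', adj'⟩ := h'
  obtain ⟨σ, hσ⟩ := exists_equiv_eqOn_of_card_eq hVW {c, p, q, o}
    (f := fun x => if x = c then c' else if x = p then p' else if x = q then q' else o') (by
      intro x hx y hy hxy
      simp only [Finset.coe_insert, Finset.coe_singleton, Set.mem_insert_iff,
        Set.mem_singleton_iff] at hx hy
      grind)
  have hc : ∀ x, σ x = c' ↔ x = c := fun x => by
    rw [show c' = σ c by rw [hσ c (by simp)]; simp, σ.apply_eq_iff_eq]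
  have hp : ∀ x, σ x = p' ↔ x = p := fun x => by
    rw [show p' = σ p by rw [hσ p (by simp)]; simp [cp.symm], σ.apply_eq_iff_eq]
  have hq : ∀ x, σ x = q' ↔ x = q := fun x => by
    rw [show q' = σ q by rw [hσ q (by simp)]; simp [cq.symm, pq.symm], σ.apply_eq_iff_eq]
  have ho : ∀ x, σ x = o' ↔ x = o := fun x => by
    rw [show o' = σ o by rw [hσ o (by simp)]; simp [co.symm, po.symm, qo.symm], σ.apply_eq_iff_eq]
  exact ⟨σ, fun {x y} => by simp only [adj, adj', ne_eq, hc, hp, hq, ho]⟩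

open scoped Classical in
theorem IsTriangleAttached.nonempty_iso {V : Type u} {W : Type v} [Fintype V] [Fintype W]
    {G : SimpleGraph V} {H : SimpleGraph W} {c p q w : V} {c' p' q' w' : W}
    (h : IsTriangleAttached G c p q w) (h' : IsTriangleAttached H c' p' q' w')
    (hVW : Fintype.card V = Fintype.card W) : Nonempty (G ≃g H) := by
  obtain ⟨cp, cq, cw, pq, pw, qw, adj⟩ := h
  obtain ⟨cp', cq', cw', pq', pw', qw', adj'⟩ := h'
  obtain ⟨σ, hσ⟩ := exists_equiv_eqOn_of_card_eq hVW {c, p, q, w}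
    (f := fun x => if x = c then c' else if x = p then p' else if x = q then q' else w') (by
      intro x hx y hy hxy
      simp only [Finset.coe_insert, Finset.coe_singleton, Set.mem_insert_iff,
        Set.mem_singleton_iff] at hx hy
      grind)
  have hc : ∀ x, σ x = c' ↔ x = c := fun x => by
    rw [show c' = σ c by rw [hσ c (by simp)]; simp, σ.apply_eq_iff_eq]
  have hp : ∀ x, σ x = p' ↔ x = p := fun x => by
    rw [show p' = σ p by rw [hσ p (by simp)]; simp [cp.symm], σ.apply_eq_iff_eq]
  have hq : ∀ x, σ x = q' ↔ x = q := fun x => by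
    rw [show q' = σ q by rw [hσ q (by simp)]; simp [cq.symm, pq.symm], σ.apply_eq_iff_eq]
  have hw : ∀ x, σ x = w' ↔ x = w := fun x => by
    rw [show w' = σ w by rw [hσ w (by simp)]; simp [cw.symm, pw.symm, qw.symm], σ.apply_eq_iff_eq]
  exact ⟨σ, fun {x y} => by simp only [adj, adj', ne_eq, hc, hp, hq, hw]⟩

open scoped Classical in
theorem IsTrianglePath.nonempty_iso {V : Type u} {W : Type v} [Fintype V] [Fintype W]
    {G : SimpleGraph V} {H : SimpleGraph W} {c a b s w : V} {c' a' b' s' w' : W}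
    (h : IsTrianglePath G c a b s w) (h' : IsTrianglePath H c' a' b' s' w')
    (hVW : Fintype.card V = Fintype.card W) : Nonempty (G ≃g H) := by
  obtain ⟨ca, cb, cs, cw, ab, as, aw, bs, bw, sw, adj⟩ := h
  obtain ⟨ca', cb', cs', cw', ab', as', aw', bs', bw', sw', adj'⟩ := h'
  obtain ⟨σ, hσ⟩ := exists_equiv_eqOn_of_card_eq hVW {c, a, b, s, w}
    (f := fun x => if x = c then c' else if x = a then a' else if x = b then b' else
      if x = s then s' else w') (by
      intro x hx y hy hxy
      simp only [Finset.coe_insert, Finset.coe_singleton, Set.mem_insert_iff,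
        Set.mem_singleton_iff] at hx hy
      grind)
  have hc : ∀ x, σ x = c' ↔ x = c := fun x => by
    rw [show c' = σ c by rw [hσ c (by simp)]; simp, σ.apply_eq_iff_eq]
  have ha : ∀ x, σ x = a' ↔ x = a := fun x => by
    rw [show a' = σ a by rw [hσ a (by simp)]; simp [ca.symm], σ.apply_eq_iff_eq]
  have hb : ∀ x, σ x = b' ↔ x = b := fun x => by
    rw [show b' = σ b by rw [hσ b (by simp)]; simp [cb.symm, ab.symm], σ.apply_eq_iff_eq]
  have hs : ∀ x, σ x = s' ↔ x = s := fun x => by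
    rw [show s' = σ s by rw [hσ s (by simp)]; simp [cs.symm, as.symm, bs.symm], σ.apply_eq_iff_eq]
  have hw : ∀ x, σ x = w' ↔ x = w := fun x => by
    rw [show w' = σ w by rw [hσ w (by simp)]; simp [cw.symm, aw.symm, bw.symm, sw.symm],
      σ.apply_eq_iff_eq]
  exact ⟨σ, fun {x y} => by simp only [adj, adj', ne_eq, hc, ha, hb, hs, hw]⟩

-- The edges split into those at `c`, counted by the degree, and those in `F`; connectedness holds
-- because every vertex is within distance two of `c`.
open scoped Classical in
theorem isUnicyclic_of_edges_not_mem {V : Type u} [Fintype V] {G : SimpleGraph V} {c : V}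
    {F : Finset (Sym2 V)} (hF : ∀ e, e ∈ F ↔ e ∈ G.edgeSet ∧ c ∉ e)
    (hcard : F.card + G.degree c = Fintype.card V)
    (hcon : ∀ x, x = c ∨ G.Adj c x ∨ ∃ y, G.Adj c y ∧ G.Adj y x) : IsUnicyclic G := by
  constructor
  · have hr : ∀ x, G.Reachable c x := by
      intro x
      rcases hcon x with rfl | h | ⟨y, h, h'⟩
      · exact SimpleGraph.Reachable.refl _
      · exact h.reachable
      · exact h.reachable.trans h'.reachable
    have : Nonempty V := ⟨c⟩
    exact SimpleGraph.Connected.mk fun x y => (hr x).symm.trans (hr y)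
  · rw [Set.ncard_eq_toFinset_card', ← hcard, ← G.card_incidenceFinset_eq_degree,
      SimpleGraph.incidenceFinset_eq_filter,
      show F = {e ∈ G.edgeFinset | ¬ c ∈ e} by
        ext e; rw [hF, Finset.mem_filter, SimpleGraph.mem_edgeFinset],
      add_comm, Finset.card_filter_add_card_filter_not]
    rfl

open scoped Classical in
theorem IsStarPlusEdge.isUnicyclic {V : Type u} [Fintype V] {G : SimpleGraph V} {c a b : V}
    (h : IsStarPlusEdge G c a b) : IsUnicyclic G := by
  -- Only the degree of the centre is extracted, so any admissible `R` serves.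
  have hdeg := (h.exists_weights rfl (le_refl 4)).2.1
  obtain ⟨ca, cb, ab, adj⟩ := h
  refine isUnicyclic_of_edges_not_mem (c := c) (F := {s(a, b)}) (fun e => ?_) ?_ fun x => ?_
  · induction e with | _ x y
    simp only [Finset.mem_singleton, Sym2.eq_iff, SimpleGraph.mem_edgeSet, Sym2.mem_iff, adj]
    grind
  · rw [Finset.card_singleton]
    have : ((1 + G.degree c : ℕ) : ℝ) = Fintype.card V := by push_cast; linarith
    exact_mod_cast this
  · simp only [adj]
    grind

open scoped Classical in
theorem IsQuadrangleStar.isUnicyclic {V : Type u} [Fintype V] {G : SimpleGraph V} {c p q o : V}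
    (h : IsQuadrangleStar G c p q o) : IsUnicyclic G := by
  have hdeg := (h.exists_weights rfl (le_refl 4)).2.1
  obtain ⟨cp, cq, co, pq, po, qo, adj⟩ := h
  refine isUnicyclic_of_edges_not_mem (c := c) (F := {s(o, p), s(o, q)}) (fun e => ?_) ?_
    fun x => ?_
  · induction e with | _ x y
    simp only [Finset.mem_insert, Finset.mem_singleton, Sym2.eq_iff, SimpleGraph.mem_edgeSet,
      Sym2.mem_iff, adj]
    grind
  · rw [Finset.card_pair (by simp [pq, qo.symm])]
    have : ((2 + G.degree c : ℕ) : ℝ) = Fintype.card V := by push_cast; linarith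
    exact_mod_cast this
  · by_cases hx : x = o
    · exact Or.inr (Or.inr ⟨p, (adj _ _).2 (by grind), (adj _ _).2 (by grind)⟩)
    · simp only [adj]
      grind

open scoped Classical in
theorem IsTriangleAttached.isUnicyclic {V : Type u} [Fintype V] {G : SimpleGraph V}
    {c p q w : V} (h : IsTriangleAttached G c p q w) : IsUnicyclic G := by
  have hdeg := (h.exists_weights rfl (le_refl 4)).2.1
  obtain ⟨cp, cq, cw, pq, pw, qw, adj⟩ := h
  refine isUnicyclic_of_edges_not_mem (c := c) (F := {s(p, q), s(p, w)}) (fun e => ?_) ?_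
    fun x => ?_
  · induction e with | _ x y
    simp only [Finset.mem_insert, Finset.mem_singleton, Sym2.eq_iff, SimpleGraph.mem_edgeSet,
      Sym2.mem_iff, adj]
    grind
  · rw [Finset.card_pair (by simp [qw, pw])]
    have : ((2 + G.degree c : ℕ) : ℝ) = Fintype.card V := by push_cast; linarith
    exact_mod_cast this
  · by_cases hx : x = w
    · exact Or.inr (Or.inr ⟨p, (adj _ _).2 (by grind), (adj _ _).2 (by grind)⟩)
    · simp only [adj]
      grind

open scoped Classical in
theorem IsTrianglePath.isUnicyclic {V : Type u} [Fintype V] {G : SimpleGraph V}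
    {c a b s w : V} (h : IsTrianglePath G c a b s w) : IsUnicyclic G := by
  have hdeg := (h.exists_weights rfl (le_refl 4)).2.1
  obtain ⟨ca, cb, cs, cw, ab, as, aw, bs, bw, sw, adj⟩ := h
  refine isUnicyclic_of_edges_not_mem (c := c) (F := {s(a, b), s(s, w)}) (fun e => ?_) ?_
    fun x => ?_
  · induction e with | _ x y
    simp only [Finset.mem_insert, Finset.mem_singleton, Sym2.eq_iff, SimpleGraph.mem_edgeSet,
      Sym2.mem_iff, adj]
    grind
  · rw [Finset.card_pair (by simp [as, aw])]
    have : ((2 + G.degree c : ℕ) : ℝ) = Fintype.card V := by push_cast; linarith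
    exact_mod_cast this
  · by_cases hx : x = w
    · exact Or.inr (Or.inr ⟨s, (adj _ _).2 (by grind), (adj _ _).2 (by grind)⟩)
    · simp only [adj]
      grind

open scoped Classical in
/-- A unicyclic graph with a vertex adjacent to all others is a star plus an edge. -/
theorem IsUnicyclic.exists_isStarPlusEdge {V : Type u} [Fintype V] {G : SimpleGraph V}
    (hG : IsUnicyclic G) {c : V} (hc : G.degree c + 1 = Fintype.card V) :
    ∃ a b, IsStarPlusEdge G c a b := by
  have h1 := hG.card_edges_not_mem c
  obtain ⟨e, he⟩ := Finset.card_eq_one.1 (show {e ∈ G.edgeFinset | c ∉ e}.card = 1 by omega)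
  have hN : insert c (G.neighborFinset c) = Finset.univ := by
    rw [← Finset.card_eq_iff_eq_univ, Finset.card_insert_of_notMem (by simp),
      G.card_neighborFinset_eq_degree, hc]
  have hN' : ∀ x, x ≠ c → G.Adj c x := fun x hx => by
    have := Finset.mem_univ x
    rw [← hN] at this
    simpa [hx] using this
  induction e with | _ a b
  have hE : ∀ x y, (G.Adj x y ∧ c ≠ x ∧ c ≠ y) ↔ s(x, y) = s(a, b) := fun x y => by
    rw [← Finset.mem_singleton, ← he]
    simp
  obtain ⟨hab, hca, hcb⟩ := (hE a b).2 rfl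
  refine ⟨a, b, hca, hcb, hab.ne, fun x y => ?_⟩
  have := hE x y
  rw [Sym2.eq_iff] at this
  have hx := hN' x
  have hy := hN' y
  have := G.adj_comm x y
  have := G.loopless.irrefl c
  grind

open scoped Classical in
/-- A unicyclic graph with a vertex adjacent to all others but one is a quadrangle with pendent
vertices, or a star plus an edge with a pendent vertex attached to a non-centre. -/
theorem IsUnicyclic.exists_of_degree_add_two {V : Type u} [Fintype V] {G : SimpleGraph V}
    (hG : IsUnicyclic G) {c : V} (hc : G.degree c + 2 = Fintype.card V) :
    (∃ p q o, IsQuadrangleStar G c p q o) ∨ (∃ p q w, IsTriangleAttached G c p q w) ∨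
      ∃ a b s w, IsTrianglePath G c a b s w := by
  have h1 := hG.card_edges_not_mem c
  obtain ⟨w, hw⟩ := Finset.card_eq_one.1 (show (insert c (G.neighborFinset c))ᶜ.card = 1 by
    rw [Finset.card_compl, Finset.card_insert_of_notMem (by simp),
      G.card_neighborFinset_eq_degree]
    omega)
  have hN : ∀ x, (x ≠ c ∧ ¬ G.Adj c x) ↔ x = w := fun x => by
    rw [← Finset.mem_singleton, ← hw]
    simp
  obtain ⟨hwc, hcw⟩ := (hN w).2 rfl
  obtain ⟨v, hwv⟩ := (G.degree_pos_iff_exists_adj w).1 (hG.degree_pos (by omega) w)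
  have hvc : v ≠ c := by rintro rfl; exact hcw hwv.symm
  -- Of the `n` edges, `n - 2` meet `c`. One of the two others joins the non-neighbour `w` of `c` to
  -- some `v`; call the second one `ab`.
  obtain ⟨f, hf⟩ : ∃ f, {e ∈ G.edgeFinset | c ∉ e} = {s(w, v), f} ∧ f ≠ s(w, v) := by
    obtain ⟨e₁, e₂, hne, he⟩ :=
      Finset.card_eq_two.1 (show {e ∈ G.edgeFinset | c ∉ e}.card = 2 by omega)
    have hmem : s(w, v) ∈ ({e₁, e₂} : Finset (Sym2 V)) := by
      rw [← he]
      simp [hwv, hwc.symm, hvc.symm]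
    simp only [Finset.mem_insert, Finset.mem_singleton] at hmem
    rcases hmem with rfl | rfl
    · exact ⟨e₂, he, hne.symm⟩
    · exact ⟨e₁, by rw [he, Finset.pair_comm], hne⟩
  obtain ⟨hf, hne⟩ := hf
  induction f with | _ a b
  have hE : ∀ x y, (G.Adj x y ∧ c ≠ x ∧ c ≠ y) ↔ s(x, y) = s(w, v) ∨ s(x, y) = s(a, b) :=
    fun x y => by
      rw [← Finset.mem_singleton (b := s(x, y)) (a := s(a, b)), ← Finset.mem_insert, ← hf]
      simp
  obtain ⟨hab, hca, hcb⟩ := (hE a b).2 (Or.inr rfl)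
  have hab' := hab.ne
  have hwv' := hwv.ne
  have hadj : ∀ x y, G.Adj x y ↔ (x = c ∧ y ≠ c ∧ y ≠ w) ∨ (y = c ∧ x ≠ c ∧ x ≠ w) ∨
      (x = w ∧ y = v) ∨ (x = v ∧ y = w) ∨ (x = a ∧ y = b) ∨ (x = b ∧ y = a) := by
    intro x y
    have := hE x y
    rw [Sym2.eq_iff, Sym2.eq_iff] at this
    have hx := hN x
    have hy := hN y
    have := G.adj_comm x y
    have := G.loopless.irrefl c
    grind
  -- The shape depends on how `ab` meets `wv`: a common end `w` gives the quadrangle, a common end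
  -- `v` the triangle with `w` hanging at `v`, and disjoint edges the triangle with the path `c - v
  -- - w`. Swapping `a` and `b` if necessary gives `b ≠ w`.
  have key : ∀ a b, c ≠ a → c ≠ b → a ≠ b → s(a, b) ≠ s(w, v) → b ≠ w →
      (∀ x y, G.Adj x y ↔ (x = c ∧ y ≠ c ∧ y ≠ w) ∨ (y = c ∧ x ≠ c ∧ x ≠ w) ∨
      (x = w ∧ y = v) ∨ (x = v ∧ y = w) ∨ (x = a ∧ y = b) ∨ (x = b ∧ y = a)) →
      (∃ p q o, IsQuadrangleStar G c p q o) ∨ (∃ p q w, IsTriangleAttached G c p q w) ∨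
      ∃ a b s w, IsTrianglePath G c a b s w := by
    intro a b hca hcb hab hne hbw hadj
    by_cases haw : a = w
    · subst haw
      have hbv : b ≠ v := by rintro rfl; exact hne rfl
      exact Or.inl ⟨v, b, a, hvc.symm, hcb, hca, hbv.symm, hwv'.symm, hbw, fun x y => by
        rw [hadj]; grind⟩
    · by_cases hav : a = v
      · subst hav
        exact Or.inr (Or.inl ⟨a, b, w, hca, hcb, hwc.symm, hab, haw, hbw, fun x y => by
          rw [hadj]; grind⟩)
      · by_cases hbv : b = v
        · subst hbv
          exact Or.inr (Or.inl ⟨b, a, w, hcb, hca, hwc.symm, hab.symm, hbw, haw, fun x y => by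
            rw [hadj]; grind⟩)
        · exact Or.inr (Or.inr ⟨a, b, v, w, hca, hcb, hvc.symm, hwc.symm, hab, hav, haw, hbv, hbw,
            hwv'.symm, fun x y => by rw [hadj]; grind⟩)
  by_cases hbw : b = w
  · refine key b a hcb hca hab'.symm (by rwa [Sym2.eq_swap]) (fun h => hab' (h.trans hbw.symm))
      fun x y => ?_
    rw [hadj]
    grind
  · exact key a b hca hcb hab' hne hbw hadj

theorem isStarPlusEdge_starPlusEdge {n : ℕ} (hn : 5 ≤ n) :
    IsStarPlusEdge (starPlusEdge n) ⟨0, by omega⟩ ⟨1, by omega⟩ ⟨2, by omega⟩ := by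
  constructor
  all_goals simp only [ne_eq, starPlusEdge, SimpleGraph.fromRel_adj, Fin.ext_iff]
  all_goals omega

theorem isQuadrangleStar_graphG1 {n : ℕ} (hn : 5 ≤ n) :
    IsQuadrangleStar (graphG1 n) ⟨0, by omega⟩ ⟨1, by omega⟩ ⟨3, by omega⟩ ⟨2, by omega⟩ := by
  constructor
  all_goals simp only [ne_eq, graphG1, SimpleGraph.fromRel_adj, Fin.ext_iff]
  all_goals omega

theorem isTriangleAttached_graphG2 {n : ℕ} (hn : 5 ≤ n) :
    IsTriangleAttached (graphG2 n) ⟨0, by omega⟩ ⟨1, by omega⟩ ⟨2, by omega⟩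
      ⟨n - 1, by omega⟩ := by
  constructor
  all_goals simp only [ne_eq, graphG2, SimpleGraph.fromRel_adj, Fin.ext_iff]
  all_goals omega

theorem isTrianglePath_graphG3 {n : ℕ} (hn : 5 ≤ n) :
    IsTrianglePath (graphG3 n) ⟨0, by omega⟩ ⟨1, by omega⟩ ⟨2, by omega⟩ ⟨3, by omega⟩
      ⟨n - 1, by omega⟩ := by
  constructor
  all_goals simp only [ne_eq, graphG3, SimpleGraph.fromRel_adj, Fin.ext_iff]
  all_goals omega

/-! ### Upper bounds for unicyclic graphs of maximal degree at most `n - 3`. -/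

open scoped Classical in
theorem agRow_one {V : Type u} [Fintype V] (G : SimpleGraph V) (i : V) :
    agRow G (fun _ => 1) i = (G.degree i : ℝ) ^ 2 + nbrSum G i := by
  simp only [agRow, mul_one, Finset.sum_add_distrib, Finset.sum_const, nsmul_eq_mul,
    G.card_neighborFinset_eq_degree, nbrSum, Nat.cast_sum]
  ring

open scoped Classical in
theorem agRow_ite {V : Type u} [Fintype V] (G : SimpleGraph V) (c i : V) (t : ℝ) :
    agRow G (fun j => if j = c then t else 1) i = (G.degree i : ℝ) ^ 2 + nbrSum G i +
      if G.Adj i c then (t - 1) * (G.degree i + G.degree c) else 0 := by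
  have : ∀ j, ((G.degree i : ℝ) + G.degree j) * (if j = c then t else 1) =
      ((G.degree i : ℝ) + G.degree j) * 1 +
        if j = c then (t - 1) * ((G.degree i : ℝ) + G.degree c) else 0 := fun j => by
    split_ifs with h
    · rw [h]; ring
    · ring
  rw [← agRow_one, agRow, agRow, Finset.sum_congr rfl fun j _ => this j, Finset.sum_add_distrib,
    Finset.sum_ite_eq']
  simp only [SimpleGraph.mem_neighborFinset]

open scoped Classical in
theorem agSpectralRadius_le_of_degree_sq_add_nbrSum_le {V : Type u} [Fintype V]
    {G : SimpleGraph V} [Nonempty V] (hd : ∀ i, 0 < G.degree i) {R : ℝ}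
    (h : ∀ i, (G.degree i : ℝ) ^ 2 + nbrSum G i ≤ R * G.degree i) :
    agSpectralRadius G ≤ R / 2 :=
  agSpectralRadius_le_of_agRow_le G hd (z := fun _ => 1) (fun _ => one_pos) fun i => by
    rw [agRow_one, mul_one]; exact h i

-- Raising the weight of one vertex `c` from `1` to `t` relaxes its own row by the factor `t`, and
-- costs each neighbour `i` only `(t - 1)(d_i + d_c)`.
open scoped Classical in
theorem agSpectralRadius_le_of_heavy_vertex {V : Type u} [Fintype V]
    {G : SimpleGraph V} (hd : ∀ i, 0 < G.degree i) {R t : ℝ} (ht : 1 ≤ t) {c : V}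
    (hc : (G.degree c : ℝ) ^ 2 + nbrSum G c ≤ R * (G.degree c * t))
    (h : ∀ i, i ≠ c → (G.degree i : ℝ) ^ 2 + nbrSum G i + (t - 1) * (G.degree i + G.degree c)
      ≤ R * G.degree i) :
    agSpectralRadius G ≤ R / 2 := by
  have : Nonempty V := ⟨c⟩
  refine agSpectralRadius_le_of_agRow_le G hd (z := fun j => if j = c then t else 1)
    (fun j => by split_ifs <;> linarith) fun i => ?_
  rw [agRow_ite]
  by_cases hi : i = c
  · subst hi
    simpa using hc
  · have h1 := h i hi
    rw [if_neg hi, mul_one]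
    refine le_trans ?_ h1
    gcongr
    split_ifs
    · exact le_rfl
    · have : 0 ≤ t - 1 := by linarith
      positivity

open scoped Classical in
theorem nbrSum_le_mul {V : Type u} [Fintype V] {G : SimpleGraph V} {i : V} {Δ : ℕ}
    (h : ∀ j, G.degree j ≤ Δ) : nbrSum G i ≤ G.degree i * Δ := by
  rw [nbrSum, ← G.card_neighborFinset_eq_degree, ← smul_eq_mul]
  exact Finset.sum_le_card_nsmul _ _ _ fun j _ => h j

open scoped Classical in
theorem nbrSum_le_add_mul {V : Type u} [Fintype V] {G : SimpleGraph V} {i j : V} {Δ : ℕ}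
    (hij : G.Adj i j) (h : ∀ k, k ≠ j → G.degree k ≤ Δ) :
    nbrSum G i ≤ G.degree j + (G.degree i - 1) * Δ := by
  have hj : j ∈ G.neighborFinset i := by simpa using hij
  rw [nbrSum, ← Finset.add_sum_erase _ _ hj, ← G.card_neighborFinset_eq_degree i,
    ← Finset.card_erase_of_mem hj, ← smul_eq_mul]
  gcongr
  exact Finset.sum_le_card_nsmul _ _ _ fun k hk => h k (Finset.ne_of_mem_erase hk)

open scoped Classical in
theorem IsUnicyclic.agSpectralRadius_le_of_five {V : Type u} [Fintype V] {G : SimpleGraph V}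
    (hG : IsUnicyclic G) (hn : Fintype.card V = 5) (hdeg : ∀ i, G.degree i ≤ 2) :
    agSpectralRadius G ≤ 4 / 2 := by
  have := hG.1.nonempty
  have hpos := hG.degree_pos (by omega)
  refine agSpectralRadius_le_of_degree_sq_add_nbrSum_le hpos fun i => ?_
  have h1 := nbrSum_le_mul (i := i) hdeg
  have h2 : G.degree i ^ 2 + nbrSum G i ≤ 4 * G.degree i := by nlinarith [hdeg i]
  exact_mod_cast h2

-- Constant weights suffice: at degree `n - 3 = D - 1` the quotient `d + (n + 1)/d` equals `D + 4/(D
-- - 1)`, and by convexity it is no larger at the other degrees `≥ 2`.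
open scoped Classical in
theorem IsUnicyclic.agSpectralRadius_le_of_ten_le {V : Type u} [Fintype V] {G : SimpleGraph V}
    (hG : IsUnicyclic G) (hn : 10 ≤ Fintype.card V)
    (hdeg : ∀ i, G.degree i ≤ Fintype.card V - 3) {D : ℝ} (hD : (Fintype.card V : ℝ) - 2 = D) :
    agSpectralRadius G ≤ (D + 4 / (D - 1)) / 2 := by
  have := hG.1.nonempty
  have hpos := hG.degree_pos (by omega)
  have hn' : (10 : ℝ) ≤ Fintype.card V := by exact_mod_cast hn
  have hdeg' : ∀ i, (G.degree i : ℝ) ≤ D - 1 := fun i => by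
    have : ((G.degree i + 3 : ℕ) : ℝ) ≤ Fintype.card V := by
      have := hdeg i
      exact_mod_cast (by omega : G.degree i + 3 ≤ Fintype.card V)
    push_cast at this
    linarith
  have h0 : (0 : ℝ) < 4 / (D - 1) := div_pos (by norm_num) (by linarith)
  have h00 : 4 / (D - 1) * (D - 1) = 4 := div_mul_cancel₀ _ (by linarith)
  refine agSpectralRadius_le_of_degree_sq_add_nbrSum_le hpos fun i => ?_
  -- At a leaf the bound `n + 1` on the neighbour sum is too weak; the sum is a single degree, at
  -- most `D - 1`.
  by_cases hi : G.degree i = 1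
  · have h1 := nbrSum_le_mul (i := i) hdeg
    have h2 : (nbrSum G i : ℝ) ≤ D - 1 := by
      have : ((nbrSum G i + 3 : ℕ) : ℝ) ≤ Fintype.card V := by
        rw [hi, one_mul] at h1
        exact_mod_cast (by omega : nbrSum G i + 3 ≤ Fintype.card V)
      push_cast at this
      linarith
    rw [hi]
    push_cast
    linarith
  · have h2 : (2 : ℝ) ≤ G.degree i := by
      have := hpos i
      exact_mod_cast (by omega : 2 ≤ G.degree i)
    have h3 : (nbrSum G i : ℝ) ≤ D + 3 := by
      have : (nbrSum G i : ℝ) ≤ ((Fintype.card V + 1 : ℕ) : ℝ) := by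
        exact_mod_cast hG.nbrSum_le i
      push_cast at this
      linarith
    have h4 : 4 / (D - 1) ≤ 1 := (div_le_one (by linarith)).2 (by linarith)
    -- The quadratic `d² - R d + (D + 3)` has roots exactly `D - 1` and `1 + 4/(D - 1)`, and `d`
    -- lies between them.
    nlinarith [mul_nonneg (sub_nonneg.2 (hdeg' i))
      (by linarith : 0 ≤ (G.degree i : ℝ) - (1 + 4 / (D - 1)))]

open scoped Classical in
/-- If at most one vertex has the maximal possible degree `n - 3`, the bound on the spectral radius
reduces to numerical conditions on the degrees and the sums of the degrees of the neighbours. -/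
theorem IsUnicyclic.agSpectralRadius_le_of_unique_heavy {V : Type u} [Fintype V]
    {G : SimpleGraph V} (hG : IsUnicyclic G) {Δ : ℕ} (hΔ : Δ + 3 = Fintype.card V)
    (hdeg : ∀ i, G.degree i ≤ Δ) (huniq : ∀ i j, G.degree i = Δ → G.degree j = Δ → i = j)
    {R t : ℝ} (ht : 1 ≤ t)
    (hc : (Δ : ℝ) ^ 2 + (Δ + 4) ≤ R * (Δ * t))
    (h : ∀ i, G.degree i < Δ →
      (G.degree i : ℝ) ^ 2 + nbrSum G i + (t - 1) * (G.degree i + Δ) ≤ R * G.degree i) :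
    agSpectralRadius G ≤ R / 2 := by
  have := hG.1.nonempty
  have hpos := hG.degree_pos (by omega)
  by_cases hex : ∃ c, G.degree c = Δ
  · obtain ⟨c, hcΔ⟩ := hex
    refine agSpectralRadius_le_of_heavy_vertex hpos ht (c := c) ?_ fun i hi => ?_
    · rw [hcΔ]
      refine le_trans ?_ hc
      have : (nbrSum G c : ℝ) ≤ ((Δ + 4 : ℕ) : ℝ) := by
        have := hG.nbrSum_le c
        exact_mod_cast (by omega : nbrSum G c ≤ Δ + 4)
      push_cast at this
      linarith
    · rw [hcΔ]
      exact h i (lt_of_le_of_ne (hdeg i) fun h' => hi (huniq _ _ h' hcΔ))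
  · push Not at hex
    -- Without a vertex of degree `Δ`, constant weights work, because the surcharge `(t - 1)(d_i +
    -- Δ)` in `h` is nonnegative.
    refine agSpectralRadius_le_of_degree_sq_add_nbrSum_le hpos fun i => ?_
    refine le_trans ?_ (h i (lt_of_le_of_ne (hdeg i) (hex i)))
    have : 0 ≤ (t - 1) * ((G.degree i : ℝ) + Δ) :=
      mul_nonneg (by linarith) (by positivity)
    linarith

-- The constant `6.75` lies just below `2ρ(G₃)` for `n = 8`. Constant weights narrowly fail at
-- degree `5` (`34 > 33.75`), hence `t = 1.02`. Two vertices of degree `5` would need at least nine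
-- edges.
open scoped Classical in
theorem IsUnicyclic.agSpectralRadius_le_of_eight {V : Type u} [Fintype V] {G : SimpleGraph V}
    (hG : IsUnicyclic G) (hn : Fintype.card V = 8) (hdeg : ∀ i, G.degree i ≤ 5) :
    agSpectralRadius G ≤ 6.75 / 2 := by
  refine hG.agSpectralRadius_le_of_unique_heavy (Δ := 5) (t := 1.02) (by omega) hdeg ?_
    (by norm_num) (by norm_num) fun i hi => ?_
  · intro i j hi hj
    by_contra hne
    have := hG.degree_add_degree hne
    split_ifs at this <;> omega
  · have h1 := nbrSum_le_mul (i := i) hdeg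
    have h2 := hG.nbrSum_le i
    have h3 := hG.degree_pos (by omega) i
    rw [hn] at h2
    generalize G.degree i = d at *
    have h1' : (nbrSum G i : ℝ) ≤ d * 5 := by exact_mod_cast h1
    have h2' : (nbrSum G i : ℝ) ≤ 8 + 1 := by exact_mod_cast h2
    interval_cases d <;> push_cast at * <;> linarith

open scoped Classical in
theorem IsUnicyclic.agSpectralRadius_le_of_nine {V : Type u} [Fintype V] {G : SimpleGraph V}
    (hG : IsUnicyclic G) (hn : Fintype.card V = 9) (hdeg : ∀ i, G.degree i ≤ 6) :
    agSpectralRadius G ≤ 7.64 / 2 := by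
  refine hG.agSpectralRadius_le_of_unique_heavy (Δ := 6) (t := 1.01) (by omega) hdeg ?_
    (by norm_num) (by norm_num) fun i hi => ?_
  · intro i j hi hj
    by_contra hne
    have := hG.degree_add_degree hne
    split_ifs at this <;> omega
  · have h1 := nbrSum_le_mul (i := i) hdeg
    have h2 := hG.nbrSum_le i
    have h3 := hG.degree_pos (by omega) i
    rw [hn] at h2
    generalize G.degree i = d at *
    have h1' : (nbrSum G i : ℝ) ≤ d * 6 := by exact_mod_cast h1
    have h2' : (nbrSum G i : ℝ) ≤ 9 + 1 := by exact_mod_cast h2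
    interval_cases d <;> push_cast at * <;> linarith

open scoped Classical in
theorem nbrSum_eq_of_neighborFinset {V : Type u} [Fintype V] {G : SimpleGraph V} {i : V}
    {s : Finset V} (h : G.neighborFinset i = s) : nbrSum G i = ∑ j ∈ s, G.degree j := by
  rw [nbrSum, h]

open scoped Classical in
theorem IsUnicyclic.agSpectralRadius_le_of_seven_of_unique {V : Type u} [Fintype V]
    {G : SimpleGraph V}
    (hG : IsUnicyclic G) (hn : Fintype.card V = 7) (hdeg : ∀ i, G.degree i ≤ 4)
    (huniq : ∀ i j, G.degree i = 4 → G.degree j = 4 → i = j) :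
    agSpectralRadius G ≤ 5.86 / 2 := by
  refine hG.agSpectralRadius_le_of_unique_heavy (Δ := 4) (t := 1.03) (by omega) hdeg huniq
    (by norm_num) (by norm_num) fun i hi => ?_
  have h1 := nbrSum_le_mul (i := i) hdeg
  have h2 := hG.nbrSum_le i
  have h3 := hG.degree_pos (by omega) i
  -- A neighbour sum of `8` would violate the row of a degree-two vertex, but it would require two
  -- neighbours of degree `4`.
  have h4 : G.degree i = 2 → nbrSum G i ≤ 7 := by
    intro hi2
    rw [← G.card_neighborFinset_eq_degree] at hi2
    obtain ⟨a, b, hab, hN⟩ := Finset.card_eq_two.1 hi2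
    rw [nbrSum_eq_of_neighborFinset hN, Finset.sum_pair hab]
    have ha := hdeg a
    have hb := hdeg b
    by_contra hlt
    exact hab (huniq a b (by omega) (by omega))
  rw [hn] at h2
  generalize G.degree i = d at *
  have h1' : (nbrSum G i : ℝ) ≤ d * 4 := by exact_mod_cast h1
  have h2' : (nbrSum G i : ℝ) ≤ 7 + 1 := by exact_mod_cast h2
  have h4' : d = 2 → (nbrSum G i : ℝ) ≤ 7 := fun h => by exact_mod_cast h4 h
  interval_cases d
  · push_cast at *; linarith
  · have := h4' rfl
    push_cast; linarith
  · push_cast; linarith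

-- Two vertices of degree `4` with only seven edges must be adjacent and meet every edge. All other
-- vertices then have neighbours only among these two, and weights depending on the degree alone
-- suffice.
open scoped Classical in
theorem IsUnicyclic.agSpectralRadius_le_of_seven_of_two {V : Type u} [Fintype V]
    {G : SimpleGraph V} (hG : IsUnicyclic G) (hn : Fintype.card V = 7) {x y : V} (hxy : x ≠ y)
    (hx : G.degree x = 4) (hy : G.degree y = 4) :
    agSpectralRadius G ≤ 5.86 / 2 := by
  have := hG.1.nonempty
  have hpos := hG.degree_pos (by omega)
  have hadd := hG.degree_add_degree hxy
  rw [hx, hy, hn] at hadd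
  have hadj : G.Adj x y := by
    by_contra h
    rw [if_neg h] at hadd
    omega
  rw [if_pos hadj] at hadd
  have hE : {e ∈ G.edgeFinset | x ∉ e ∧ y ∉ e} = ∅ := Finset.card_eq_zero.1 (by omega)
  have hN : ∀ i j, G.Adj i j → i ≠ x → i ≠ y → j = x ∨ j = y := by
    intro i j hij hix hiy
    by_contra hne
    push Not at hne
    have : s(i, j) ∈ ({e ∈ G.edgeFinset | x ∉ e ∧ y ∉ e} : Finset (Sym2 V)) := by
      simp [hij, hix.symm, hiy.symm, hne.1.symm, hne.2.symm]
    rw [hE] at this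
    simp at this
  have hle2 : ∀ i, i ≠ x → i ≠ y → G.degree i ≤ 2 := by
    intro i hix hiy
    rw [← G.card_neighborFinset_eq_degree]
    refine (Finset.card_le_card (t := {x, y}) fun j hj => ?_).trans Finset.card_le_two
    simpa using hN i j (by simpa using hj) hix hiy
  let z : V → ℝ := fun j => if G.degree j = 4 then 1.1 else if G.degree j = 2 then 1.13 else 1
  have hcentre : ∀ x y, x ≠ y → G.degree x = 4 → G.degree y = 4 → G.Adj x y →
      (∀ i, i ≠ x → i ≠ y → G.degree i ≤ 2) → agRow G z x ≤ 5.86 * (G.degree x * z x) := by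
    intro x y hxy hx hy hadj hle2
    have hyx : y ∈ G.neighborFinset x := by simpa using hadj
    -- The affine function `3.22 + 1.78 d` equals the summand at degrees `1` and `2`, and `-1.54`
    -- corrects it at `y`. The row is thereby reduced to the neighbour sum, at most `8`.
    calc agRow G z x ≤ ∑ j ∈ G.neighborFinset x,
          (3.22 + 1.78 * (G.degree j : ℝ) + if y = j then -1.54 else 0) := by
          rw [agRow]
          refine Finset.sum_le_sum fun j hj => ?_
          rw [hx]
          by_cases hjy : y = j
          · subst hjy
            simp only [z, hy]
            norm_num
          · have h1 := hle2 j (by rintro rfl; simp at hj) (Ne.symm hjy)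
            have h2 := hpos j
            simp only [z, hjy, if_false]
            generalize G.degree j = d at *
            interval_cases d <;> norm_num
      _ = 4 * 3.22 + 1.78 * (nbrSum G x : ℝ) - 1.54 := by
          rw [Finset.sum_add_distrib, Finset.sum_add_distrib, Finset.sum_ite_eq, if_pos hyx,
            ← Finset.mul_sum, Finset.sum_const, G.card_neighborFinset_eq_degree, hx, nbrSum,
            Nat.cast_sum]
          norm_num
          ring
      _ ≤ _ := by
          have h1 : (nbrSum G x : ℝ) ≤ 7 + 1 := by exact_mod_cast hn ▸ hG.nbrSum_le x
          simp only [z, hx]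
          norm_num
          linarith
  refine agSpectralRadius_le_of_agRow_le G hpos (z := z) (fun i => ?_) fun i => ?_
  · simp only [z]
    split_ifs <;> norm_num
  · by_cases hix : i = x
    · rw [hix]
      exact hcentre x y hxy hx hy hadj hle2
    · by_cases hiy : i = y
      · rw [hiy]
        exact hcentre y x hxy.symm hy hx hadj.symm fun i h h' => hle2 i h' h
      · have h1 := hle2 i hix hiy
        have h2 := hpos i
        have h3 : agRow G z i ≤ G.degree i * ((G.degree i + 4) * 1.1) := by
          rw [agRow]
          calc _ ≤ (G.neighborFinset i).card • (((G.degree i : ℝ) + 4) * 1.1) := by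
                refine Finset.sum_le_card_nsmul _ _ _ fun j hj => ?_
                rcases hN i j (by simpa using hj) hix hiy with rfl | rfl
                · simp only [z, hx]; norm_num
                · simp only [z, hy]; norm_num
            _ = _ := by rw [nsmul_eq_mul, G.card_neighborFinset_eq_degree]
        refine h3.trans ?_
        simp only [z]
        generalize G.degree i = d at *
        interval_cases d <;> norm_num

open scoped Classical in
theorem IsUnicyclic.agSpectralRadius_le_of_seven {V : Type u} [Fintype V] {G : SimpleGraph V}
    (hG : IsUnicyclic G) (hn : Fintype.card V = 7) (hdeg : ∀ i, G.degree i ≤ 4) :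
    agSpectralRadius G ≤ 5.86 / 2 := by
  by_cases huniq : ∀ i j, G.degree i = 4 → G.degree j = 4 → i = j
  · exact hG.agSpectralRadius_le_of_seven_of_unique hn hdeg huniq
  · push Not at huniq
    obtain ⟨x, y, hx, hy, hxy⟩ := huniq
    exact hG.agSpectralRadius_le_of_seven_of_two hn hxy hx hy

open scoped Classical in
theorem IsUnicyclic.agSpectralRadius_le_of_six_of_three {V : Type u} [Fintype V]
    {G : SimpleGraph V} (hG : IsUnicyclic G) (hn : Fintype.card V = 6)
    {x y w : V} (hxy : x ≠ y) (hxw : x ≠ w) (hyw : y ≠ w)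
    (hx : G.degree x = 3) (hy : G.degree y = 3) (hw : G.degree w = 3) :
    agSpectralRadius G ≤ 5.056 / 2 := by
  have := hG.1.nonempty
  have hpos := hG.degree_pos (by omega)
  -- The degree sum is `12`, so the three remaining vertices share degree `3` and are leaves.
  have hdeg : ∀ i, G.degree i = 3 ∨ G.degree i = 1 := by
    intro i
    by_cases hi : i ∈ ({x, y, w} : Finset V)
    · simp only [Finset.mem_insert, Finset.mem_singleton] at hi
      rcases hi with rfl | rfl | rfl <;> omega
    · have hcard : ({x, y, w} : Finset V).card = 3 :=
        Finset.card_eq_three.2 ⟨x, y, w, hxy, hxw, hyw, rfl⟩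
      have h1 := hG.sum_degree
      rw [← Finset.add_sum_erase _ _ (Finset.mem_univ i),
        ← Finset.sum_sdiff (s₁ := {x, y, w}) (s₂ := Finset.univ.erase i)
          (fun j hj => Finset.mem_erase.2 ⟨by rintro rfl; exact hi hj, Finset.mem_univ j⟩),
        Finset.sum_insert (by simp [hxy, hxw]), Finset.sum_pair hyw, hx, hy, hw, hn] at h1
      have h2 : (Finset.univ.erase i \ {x, y, w}).card • 1 ≤
          ∑ j ∈ Finset.univ.erase i \ {x, y, w}, G.degree j :=
        Finset.card_nsmul_le_sum _ _ _ fun j _ => hpos j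
      have h3 : 2 ≤ (Finset.univ.erase i \ {x, y, w}).card := by
        have := Finset.le_card_sdiff {x, y, w} (Finset.univ.erase i)
        rw [hcard, Finset.card_erase_of_mem (Finset.mem_univ i), Finset.card_univ, hn] at this
        omega
      have := hpos i
      rw [smul_eq_mul] at h2
      omega
  let z : V → ℝ := fun j => if G.degree j = 3 then 1.263 else 1
  refine agSpectralRadius_le_of_agRow_le G hpos (z := z) (fun i => ?_) fun i => ?_
  · simp only [z]
    split_ifs <;> norm_num
  rcases hdeg i with hi | hi
  -- The affine function agrees with the summand at both possible degrees `1` and `3`, so the bound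
  -- `7` on the neighbour sum finishes the row.
  · calc agRow G z i ≤ ∑ j ∈ G.neighborFinset i, (2.211 + 1.789 * (G.degree j : ℝ)) := by
          rw [agRow]
          refine Finset.sum_le_sum fun j _ => ?_
          rcases hdeg j with hj | hj <;> simp only [z, hi, hj] <;> norm_num
      _ = 3 * 2.211 + 1.789 * (nbrSum G i : ℝ) := by
          rw [Finset.sum_add_distrib, ← Finset.mul_sum, Finset.sum_const,
            G.card_neighborFinset_eq_degree, hi, nbrSum, Nat.cast_sum]
          norm_num
      _ ≤ _ := by
          have h1 : (nbrSum G i : ℝ) ≤ 6 + 1 := by exact_mod_cast hn ▸ hG.nbrSum_le i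
          simp only [z, hi]
          norm_num
          linarith
  · have hi' := hi
    rw [← G.card_neighborFinset_eq_degree] at hi'
    obtain ⟨j, hj⟩ := Finset.card_eq_one.1 hi'
    rw [agRow, hj, Finset.sum_singleton]
    rcases hdeg j with hj | hj <;> simp only [z, hi, hj] <;> norm_num

open scoped Classical in
theorem IsUnicyclic.agSpectralRadius_le_of_six_of_not_three {V : Type u} [Fintype V]
    {G : SimpleGraph V} (hG : IsUnicyclic G) (hn : Fintype.card V = 6)
    (hdeg : ∀ i, G.degree i ≤ 3)
    (hthree : ∀ x y w, x ≠ y → x ≠ w → y ≠ w → G.degree x = 3 → G.degree y = 3 →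
      G.degree w ≠ 3) :
    agSpectralRadius G ≤ 5.056 / 2 := by
  have := hG.1.nonempty
  have hpos := hG.degree_pos (by omega)
  -- A degree-two vertex between two vertices of degree `3` has row value `10` and needs weight
  -- `0.99`. Other degree-two vertices take `0.83`, keeping the rows of degree-three vertices small.
  let z : V → ℝ := fun j => if G.degree j = 3 then 1 else if G.degree j = 1 then 0.8 else
    if nbrSum G j = 6 then 0.99 else 0.83
  have hcases : ∀ i, G.degree i = 1 ∨ G.degree i = 2 ∨ G.degree i = 3 := fun i => by
    have := hpos i
    have := hdeg i
    omega
  have z3 : ∀ i, G.degree i = 3 → z i = 1 := fun i hi => by simp only [z, hi]; norm_num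
  have z1 : ∀ i, G.degree i = 1 → z i = 0.8 := fun i hi => by simp only [z, hi]; norm_num
  have z2 : ∀ i, G.degree i = 2 → nbrSum G i = 6 → z i = 0.99 := fun i hi hi' => by
    simp only [z, hi, hi']; norm_num
  have z2' : ∀ i, G.degree i = 2 → nbrSum G i ≠ 6 → z i = 0.83 := fun i hi hi' => by
    simp only [z, hi, hi']; norm_num
  have z2nbr : ∀ i j, G.Adj i j → G.degree i = 2 → G.degree j ≠ 3 → z i = 0.83 := by
    intro i j hij hi hj
    have h1 := nbrSum_le_add_mul hij fun k _ => hdeg k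
    have := hdeg j
    exact z2' i hi (by rw [hi] at h1; omega)
  have zle : ∀ i, z i ≤ 1 := fun i => by
    simp only [z]; split_ifs <;> norm_num
  refine agSpectralRadius_le_of_agRow_le G hpos (z := z) (fun i => ?_) fun i => ?_
  · simp only [z]
    split_ifs <;> norm_num
  rcases hcases i with hi | hi | hi
  · have hi' := hi
    rw [← G.card_neighborFinset_eq_degree] at hi'
    obtain ⟨j, hj⟩ := Finset.card_eq_one.1 hi'
    have hadj : G.Adj j i := by
      rw [G.adj_comm, ← SimpleGraph.mem_neighborFinset, hj]; simp
    rw [agRow, hj, Finset.sum_singleton, hi, z1 i hi]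
    rcases hcases j with hj | hj | hj
    · rw [hj, z1 j hj]; norm_num
    · rw [hj, z2nbr j i hadj hj (by omega)]; norm_num
    · rw [hj, z3 j hj]; norm_num
  · have hi' := hi
    rw [← G.card_neighborFinset_eq_degree] at hi'
    obtain ⟨a, b, hab, hN⟩ := Finset.card_eq_two.1 hi'
    have ha : G.Adj a i := by
      rw [G.adj_comm, ← SimpleGraph.mem_neighborFinset, hN]; simp
    have hb : G.Adj b i := by
      rw [G.adj_comm, ← SimpleGraph.mem_neighborFinset, hN]; simp
    have hS : nbrSum G i = G.degree a + G.degree b := by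
      rw [nbrSum_eq_of_neighborFinset hN, Finset.sum_pair hab]
    rw [agRow, hN, Finset.sum_pair hab, hi]
    have hle : ∀ a, G.Adj a i → G.degree a ≠ 3 →
        (((2 : ℕ) : ℝ) + G.degree a) * z a ≤ 3.32 := by
      intro a ha h3
      rcases hcases a with h | h | h
      · rw [h, z1 a h]; norm_num
      · rw [h, z2nbr a i ha h (by omega)]; norm_num
      · exact absurd h h3
    have hle3 : ∀ a, G.degree a = 3 → (((2 : ℕ) : ℝ) + G.degree a) * z a = 5 := by
      intro a h
      rw [h, z3 a h]; norm_num
    by_cases ha3 : G.degree a = 3 <;> by_cases hb3 : G.degree b = 3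
    · rw [hle3 a ha3, hle3 b hb3, z2 i hi (by omega)]
      norm_num
    · have h1 := hle b hb hb3
      rw [hle3 a ha3, z2' i hi (by omega)]
      norm_num at h1 ⊢
      linarith
    · have h1 := hle a ha ha3
      rw [hle3 b hb3, z2' i hi (by omega)]
      norm_num at h1 ⊢
      linarith
    · have h1 := hle a ha ha3
      have h2 := hle b hb hb3
      rw [z2' i hi (by have := hdeg a; have := hdeg b; omega)]
      norm_num at h1 h2 ⊢
      linarith
  · have hi' := hi
    rw [← G.card_neighborFinset_eq_degree] at hi'
    obtain ⟨a, b, c, hab, hac, hbc, hN⟩ := Finset.card_eq_three.1 hi'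
    have ha : G.Adj i a := by rw [← SimpleGraph.mem_neighborFinset, hN]; simp
    have hb : G.Adj i b := by rw [← SimpleGraph.mem_neighborFinset, hN]; simp
    have hc : G.Adj i c := by rw [← SimpleGraph.mem_neighborFinset, hN]; simp
    rw [agRow, hN, Finset.sum_insert (by simp [hab, hac]), Finset.sum_pair hbc, hi, z3 i hi]
    have hle3 : ∀ a, G.degree a = 3 → (((3 : ℕ) : ℝ) + G.degree a) * z a = 6 := by
      intro a h
      rw [h, z3 a h]; norm_num
    have hle : ∀ a, G.degree a ≠ 3 → (((3 : ℕ) : ℝ) + G.degree a) * z a ≤ 4.95 := by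
      intro a h3
      rcases hcases a with h | h | h
      · rw [h, z1 a h]; norm_num
      · by_cases hS : nbrSum G a = 6
        · rw [h, z2 a h hS]; norm_num
        · rw [h, z2' a h hS]; norm_num
      · exact absurd h h3
    have hlight : ∀ a, G.degree a ≠ 3 → ¬ (G.degree a = 2 ∧ nbrSum G a = 6) →
        (((3 : ℕ) : ℝ) + G.degree a) * z a ≤ 4.15 := by
      intro a h3 h2
      rcases hcases a with h | h | h
      · rw [h, z1 a h]; norm_num
      · rw [h, z2' a h fun h' => h2 ⟨h, h'⟩]; norm_num
      · exact absurd h h3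
    have hnot3 : ∀ a b, G.Adj i a → G.Adj i b → a ≠ b → G.degree a = 3 → G.degree b ≠ 3 :=
      fun a b ha hb hab => hthree i a b ha.ne hb.ne hab hi
    -- With at most two vertices of degree `3`, namely `i` and `y`, a degree-two vertex with
    -- neighbour sum `6` must be adjacent to both.
    have hadj6 : ∀ y m, G.Adj i y → G.degree y = 3 → G.degree m = 2 → nbrSum G m = 6 →
        G.Adj y m := by
      intro y m hy hy3 hm hm6
      rw [← G.card_neighborFinset_eq_degree] at hm
      obtain ⟨p, q, hpq, hNm⟩ := Finset.card_eq_two.1 hm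
      rw [nbrSum_eq_of_neighborFinset hNm, Finset.sum_pair hpq] at hm6
      have hp := hdeg p
      have hq := hdeg q
      have hp3 : G.degree p = 3 := by omega
      have hq3 : G.degree q = 3 := by omega
      have : y ∈ G.neighborFinset m := by
        rw [hNm, Finset.mem_insert, Finset.mem_singleton]
        by_contra hne
        push Not at hne
        by_cases hip : i = p
        · exact hthree i y q hy.ne (by rwa [hip]) hne.2 hi hy3 hq3
        · exact hthree i y p hy.ne hip hne.1 hi hy3 hp3
      exact ((SimpleGraph.mem_neighborFinset ..).1 this).symm
    -- If `a` and `b` both had weight `0.99`, then `i y a` and `i y b` would be two triangles at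
    -- `i`. So one of them contributes at most `4.15`, and `4.95 + 4.15 = 9.1`.
    have hpair : ∀ y a b, G.Adj i y → G.Adj i a → G.Adj i b → y ≠ a → y ≠ b → a ≠ b →
        G.degree y = 3 →
        (((3 : ℕ) : ℝ) + G.degree a) * z a + (((3 : ℕ) : ℝ) + G.degree b) * z b ≤ 9.1 := by
      intro y a b hy ha hb hya hyb hab hy3
      have ha3 := hnot3 y a hy ha hya hy3
      have hb3 := hnot3 y b hy hb hyb hy3
      have h1 := hle a ha3
      have h2 := hle b hb3
      by_cases hA : G.degree a = 2 ∧ nbrSum G a = 6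
      · by_cases hB : G.degree b = 2 ∧ nbrSum G b = 6
        · have := hG.edge_unique_of_subset_neighborSet hy ha (hadj6 y a hy hy3 hA.1 hA.2) hy hb
            (hadj6 y b hy hy3 hB.1 hB.2)
          rw [Sym2.congr_right] at this
          exact absurd this hab
        · have := hlight b hb3 hB
          linarith
      · have := hlight a ha3 hA
        linarith
    have hR : (5.056 : ℝ) * (((3 : ℕ) : ℝ) * 1) = 15.168 := by norm_num
    rw [hR]
    by_cases ha3 : G.degree a = 3
    · have := hpair a b c ha hb hc hab hac hbc ha3
      rw [hle3 a ha3]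
      linarith
    · by_cases hb3 : G.degree b = 3
      · have := hpair b a c hb ha hc hab.symm hbc hac hb3
        rw [hle3 b hb3]
        linarith
      · by_cases hc3 : G.degree c = 3
        · have := hpair c a b hc ha hb hac.symm hbc.symm hab hc3
          rw [hle3 c hc3]
          linarith
        · have h1 := hle a ha3
          have h2 := hle b hb3
          have h3 := hle c hc3
          linarith

open scoped Classical in
theorem IsUnicyclic.agSpectralRadius_le_of_six {V : Type u} [Fintype V] {G : SimpleGraph V}
    (hG : IsUnicyclic G) (hn : Fintype.card V = 6) (hdeg : ∀ i, G.degree i ≤ 3) :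
    agSpectralRadius G ≤ 5.056 / 2 := by
  by_cases hthree : ∀ x y w, x ≠ y → x ≠ w → y ≠ w → G.degree x = 3 → G.degree y = 3 →
      G.degree w ≠ 3
  · exact hG.agSpectralRadius_le_of_six_of_not_three hn hdeg hthree
  · push Not at hthree
    obtain ⟨x, y, w, hxy, hxw, hyw, hx, hy, hw⟩ := hthree
    exact hG.agSpectralRadius_le_of_six_of_three hn hxy hxw hyw hx hy hw

/-! ### The minimum: cycles. -/

-- AM–GM for the two degrees, strict when they differ.
open scoped Classical in
theorem one_le_agMatrix {V : Type u} [Fintype V] {G : SimpleGraph V} {i j : V} (h : G.Adj i j) :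
    1 ≤ agMatrix G i j ∧ (G.degree i ≠ G.degree j → 1 < agMatrix G i j) := by
  have hi : (0 : ℝ) < G.degree i := by
    exact_mod_cast (G.degree_pos_iff_exists_adj i).2 ⟨j, h⟩
  have hj : (0 : ℝ) < G.degree j := by
    exact_mod_cast (G.degree_pos_iff_exists_adj j).2 ⟨i, h.symm⟩
  have hpos : 0 < 2 * √((G.degree i : ℝ) * G.degree j) := by
    have : 0 < √((G.degree i : ℝ) * G.degree j) := Real.sqrt_pos.2 (mul_pos hi hj)
    linarith
  rw [agMatrix_apply, if_pos h, one_le_div hpos, one_lt_div hpos]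
  have hsq : 2 * √((G.degree i : ℝ) * G.degree j) = √(4 * ((G.degree i : ℝ) * G.degree j)) := by
    rw [Real.sqrt_mul (by norm_num) (_ * _), show (4 : ℝ) = 2 ^ 2 by norm_num,
      Real.sqrt_sq (by norm_num)]
  rw [hsq]
  constructor
  · exact Real.sqrt_le_iff.2 ⟨by linarith, by nlinarith [sq_nonneg ((G.degree i : ℝ) - G.degree j)]⟩
  · intro hne
    have : (G.degree i : ℝ) - G.degree j ≠ 0 := by
      rw [sub_ne_zero]
      exact_mod_cast hne
    exact (Real.sqrt_lt' (by linarith)).2 (by nlinarith [sq_pos_of_ne_zero this])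

open scoped Classical in
theorem sum_ite_adj {V : Type u} [Fintype V] (G : SimpleGraph V) :
    ∑ i, ∑ j, (if G.Adj i j then (1 : ℝ) else 0) = ∑ i, (G.degree i : ℝ) := by
  refine Finset.sum_congr rfl fun i _ => ?_
  rw [← G.card_neighborFinset_eq_degree, SimpleGraph.neighborFinset_eq_filter, Finset.sum_boole]

theorem sum_agMatrix_le {V : Type u} [Fintype V] [Nonempty V] (G : SimpleGraph V) :
    ∑ i, ∑ j, agMatrix G i j ≤ agSpectralRadius G * Fintype.card V := by
  have := dotProduct_agMatrix_mulVec_le G 1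
  simpa [Matrix.mulVec, dotProduct] using this

open scoped Classical in
theorem ite_adj_le_agMatrix {V : Type u} [Fintype V] (G : SimpleGraph V) (i j : V) :
    (if G.Adj i j then (1 : ℝ) else 0) ≤ agMatrix G i j := by
  split_ifs with h
  · exact (one_le_agMatrix h).1
  · exact agMatrix_nonneg G i j

open scoped Classical in
theorem IsUnicyclic.two_le_agSpectralRadius {V : Type u} [Fintype V] {G : SimpleGraph V}
    (hG : IsUnicyclic G) : 2 ≤ agSpectralRadius G := by
  have := hG.1.nonempty
  have h1 := sum_agMatrix_le G
  have h2 : ∑ i, (G.degree i : ℝ) ≤ ∑ i, ∑ j, agMatrix G i j := by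
    rw [← sum_ite_adj]
    exact Finset.sum_le_sum fun i _ => Finset.sum_le_sum fun j _ => ite_adj_le_agMatrix G i j
  have h3 : ∑ i, (G.degree i : ℝ) = 2 * Fintype.card V := by exact_mod_cast hG.sum_degree
  have h4 : (0 : ℝ) < Fintype.card V := by exact_mod_cast Fintype.card_pos
  exact le_of_mul_le_mul_right (h3 ▸ h2.trans h1) h4

-- One edge with unequal end degrees would make the entry sum exceed `2n`. Degrees are therefore
-- constant along edges, hence everywhere by connectedness, and their sum `2n` fixes the value.
open scoped Classical in
theorem IsUnicyclic.degree_eq_two_of_agSpectralRadius_le {V : Type u} [Fintype V]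
    {G : SimpleGraph V} (hG : IsUnicyclic G) (h : agSpectralRadius G ≤ 2) (i : V) :
    G.degree i = 2 := by
  have := hG.1.nonempty
  have h1 := sum_agMatrix_le G
  have h4 : (0 : ℝ) < Fintype.card V := by exact_mod_cast Fintype.card_pos
  have h3 : ∑ i, (G.degree i : ℝ) = 2 * Fintype.card V := by exact_mod_cast hG.sum_degree
  have hadj : ∀ x y, G.Adj x y → G.degree x = G.degree y := by
    intro x y hxy
    by_contra hne
    have h2 : ∑ i, (G.degree i : ℝ) < ∑ i, ∑ j, agMatrix G i j := by
      rw [← sum_ite_adj]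
      refine Finset.sum_lt_sum (fun i _ => Finset.sum_le_sum fun j _ => ite_adj_le_agMatrix G i j)
        ⟨x, Finset.mem_univ x, Finset.sum_lt_sum (fun j _ => ite_adj_le_agMatrix G x j)
          ⟨y, Finset.mem_univ y, ?_⟩⟩
      rw [if_pos hxy]
      exact (one_le_agMatrix hxy).2 hne
    nlinarith
  have hreach : ∀ x y, G.Reachable x y → G.degree x = G.degree y := by
    rintro x y ⟨p⟩
    induction p with
    | nil => rfl
    | cons h _ ih => exact (hadj _ _ h).trans ih
  have hsum := hG.sum_degree
  rw [Finset.sum_congr rfl fun x _ => hreach x i (hG.1.preconnected x i), Finset.sum_const,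
    Finset.card_univ, smul_eq_mul, mul_comm] at hsum
  exact Nat.eq_of_mul_eq_mul_right Fintype.card_pos hsum

theorem degree_cycleGraph {n : ℕ} (hn : 3 ≤ n) (x : Fin n)
    [Fintype ((SimpleGraph.cycleGraph n).neighborSet x)] :
    (SimpleGraph.cycleGraph n).degree x = 2 := by
  obtain ⟨m, rfl⟩ : ∃ m, n = m + 3 := ⟨n - 3, by omega⟩
  convert SimpleGraph.cycleGraph_degree_three_le (v := x)

open scoped Classical in
/-- A connected `2`-regular graph is a cycle. -/
theorem nonempty_iso_cycleGraph {V : Type u} [Fintype V] {G : SimpleGraph V}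
    (hG : G.Connected) (hdeg : ∀ i, G.degree i = 2) {n : ℕ} (hn : Fintype.card V = n) :
    Nonempty (G ≃g SimpleGraph.cycleGraph n) := by
  obtain ⟨v⟩ := hG.nonempty
  have hncard : ∀ i, (G.neighborSet i).ncard = 2 := fun i => by
    rw [← hdeg i, ← G.card_neighborFinset_eq_degree, SimpleGraph.neighborFinset,
      Set.ncard_eq_toFinset_card']
  have hcyc : G.IsCycles := fun i _ => hncard i
  -- In a `2`-regular graph some cycle spans the component of `v`, here the whole graph; its length
  -- is therefore `n`.
  obtain ⟨p, hp, hverts⟩ := hcyc.exists_cycle_toSubgraph_verts_eq_connectedComponentSupp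
    (v := v) (c := G.connectedComponentMk v) rfl
    (Set.nonempty_of_ncard_ne_zero (by rw [hncard]; norm_num))
  have hsupp : ∀ x, x ∈ p.support := fun x => by
    rw [← SimpleGraph.Walk.mem_verts_toSubgraph, hverts]
    exact SimpleGraph.ConnectedComponent.sound (hG.preconnected x v)
  have hlen : p.length = n := by
    have h1 : p.support.tail.toFinset = Finset.univ := by
      ext x
      simp only [List.mem_toFinset, Finset.mem_univ, iff_true]
      have hx := hsupp x
      rw [SimpleGraph.Walk.mem_support_iff] at hx
      rcases hx with rfl | hx
      · exact SimpleGraph.Walk.end_mem_tail_support hp.not_nil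
      · exact hx
    rw [← hn, ← Finset.card_univ, ← h1, List.toFinset_card_of_nodup hp.support_nodup,
      List.length_tail, SimpleGraph.Walk.length_support, Nat.add_sub_cancel]
  have h3 : 3 ≤ n := hlen ▸ hp.three_le_length
  obtain ⟨f⟩ := (SimpleGraph.cycleGraph_isContained_iff (by omega)).2 ⟨v, p, hp, hlen⟩
  have hbij : Function.Bijective f :=
    (Fintype.bijective_iff_injective_and_card _).2 ⟨f.injective, by rw [Fintype.card_fin, hn]⟩
  refine ⟨(SimpleGraph.Iso.symm ⟨Equiv.ofBijective f hbij, fun {x y} => ?_⟩)⟩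
  simp only [Equiv.ofBijective_apply]
  refine ⟨fun h => ?_, fun h => f.toHom.map_adj h⟩
  -- The copy of the cycle is bijective on vertices and both graphs are `2`-regular, so
  -- neighbourhoods map onto neighbourhoods and adjacency is reflected.
  have himg : ((SimpleGraph.cycleGraph n).neighborFinset x).image f = G.neighborFinset (f x) := by
    refine Finset.eq_of_subset_of_card_le (fun w hw => ?_) ?_
    · obtain ⟨y, hy, rfl⟩ := Finset.mem_image.1 hw
      rw [SimpleGraph.mem_neighborFinset] at hy ⊢
      exact f.toHom.map_adj hy
    · rw [Finset.card_image_of_injective _ hbij.injective, SimpleGraph.card_neighborFinset_eq_degree,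
        SimpleGraph.card_neighborFinset_eq_degree, hdeg, degree_cycleGraph h3]
  have hy : f y ∈ ((SimpleGraph.cycleGraph n).neighborFinset x).image f := by
    rw [himg, SimpleGraph.mem_neighborFinset]
    exact h
  obtain ⟨y', hy', hyy⟩ := Finset.mem_image.1 hy
  rw [f.injective hyy, SimpleGraph.mem_neighborFinset] at hy'
  exact hy'

open scoped Classical in
theorem isUnicyclic_cycleGraph {n : ℕ} (hn : 5 ≤ n) :
    IsUnicyclic (SimpleGraph.cycleGraph n) := by
  constructor
  · obtain ⟨m, rfl⟩ : ∃ m, n = m + 1 := ⟨n - 1, by omega⟩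
    exact SimpleGraph.cycleGraph_connected
  · have h := (SimpleGraph.cycleGraph n).sum_degrees_eq_twice_card_edges
    rw [Finset.sum_congr rfl fun x _ => degree_cycleGraph (by omega) x, Finset.sum_const,
      Finset.card_univ, smul_eq_mul, mul_comm] at h
    rw [Set.ncard_eq_toFinset_card']
    exact (Nat.eq_of_mul_eq_mul_left two_pos h).symm

open scoped Classical in
theorem agSpectralRadius_cycleGraph {n : ℕ} (hn : 5 ≤ n) :
    agSpectralRadius (SimpleGraph.cycleGraph n) = 2 := by
  refine le_antisymm ?_ (isUnicyclic_cycleGraph hn).two_le_agSpectralRadius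
  have : Nonempty (Fin n) := ⟨⟨0, by omega⟩⟩
  have h := agSpectralRadius_le_of_degree_sq_add_nbrSum_le (G := SimpleGraph.cycleGraph n)
    (R := 4) (fun i => by rw [degree_cycleGraph (by omega)]; norm_num) fun i => by
      have h1 : (nbrSum (SimpleGraph.cycleGraph n) i : ℝ) ≤ ((2 * 2 : ℕ) : ℝ) := by
        have := nbrSum_le_mul (G := SimpleGraph.cycleGraph n) (i := i) (Δ := 2)
          fun j => by rw [degree_cycleGraph (by omega)]
        rw [degree_cycleGraph (by omega)] at this
        exact_mod_cast this
      rw [degree_cycleGraph (by omega)]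
      push_cast at h1 ⊢
      linarith
  linarith

theorem isUniqueSmallest_cycleGraph {n : ℕ} (hn : 5 ≤ n) :
    IsUniqueSmallest.{u} n (SimpleGraph.cycleGraph n) := by
  have hC := agSpectralRadius_cycleGraph hn
  refine ⟨isUnicyclic_cycleGraph hn, fun V _ G hV hG => ⟨?_, fun h => ?_, fun ⟨e⟩ => ?_⟩⟩
  · rw [hC]
    exact hG.two_le_agSpectralRadius
  · rw [hC] at h
    exact nonempty_iso_cycleGraph hG.1 (hG.degree_eq_two_of_agSpectralRadius_le h.le) hV
  · have := hG.1.nonempty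
    have : Nonempty (Fin n) := ⟨⟨0, by omega⟩⟩
    exact agSpectralRadius_eq_of_iso e

/-! ### Numerical comparison of the four extremal graphs. -/

theorem lt_agSpectralRadius_starPlusEdge {n : ℕ} (hn : 5 ≤ n) {D R : ℝ} (hD : (n : ℝ) - 1 = D)
    (hR : 4 ≤ R) (h : R * D < (D - 2) * (D + 1) ^ 2 / R + (D + 2) ^ 2 / (R - 2)) :
    R / 2 < agSpectralRadius (starPlusEdge n) :=
  lt_agSpectralRadius_of_weights
    ((isStarPlusEdge_starPlusEdge hn).exists_weights (by rwa [Fintype.card_fin]) hR) h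

theorem lt_agSpectralRadius_graphG1 {n : ℕ} (hn : 5 ≤ n) {D R : ℝ} (hD : (n : ℝ) - 2 = D)
    (hR : 4 ≤ R) (h : R * D < (D - 2) * (D + 1) ^ 2 / R + (D + 2) ^ 2 * R / (R ^ 2 - 8)) :
    R / 2 < agSpectralRadius (graphG1 n) :=
  lt_agSpectralRadius_of_weights
    ((isQuadrangleStar_graphG1 hn).exists_weights (by rwa [Fintype.card_fin]) hR) h

theorem agSpectralRadius_graphG1_le {n : ℕ} (hn : 5 ≤ n) {D R : ℝ} (hD : (n : ℝ) - 2 = D)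
    (hR : 4 ≤ R) (h : (D - 2) * (D + 1) ^ 2 / R + (D + 2) ^ 2 * R / (R ^ 2 - 8) ≤ R * D) :
    agSpectralRadius (graphG1 n) ≤ R / 2 :=
  agSpectralRadius_le_of_weights
    ((isQuadrangleStar_graphG1 hn).exists_weights (by rwa [Fintype.card_fin]) hR) h

theorem lt_agSpectralRadius_graphG2 {n : ℕ} (hn : 5 ≤ n) {D R : ℝ} (hD : (n : ℝ) - 2 = D)
    (hR : 4 ≤ R) (h : R * D < (D - 2) * (D + 1) ^ 2 / R +
        (D + 3) * ((2 * R * (D + 3) + 5 * (D + 2)) / (6 * R ^ 2 - 57)) +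
        (D + 2) * (((3 * R - 16 / R) * (D + 2) + 5 * (D + 3)) / (6 * R ^ 2 - 57))) :
    R / 2 < agSpectralRadius (graphG2 n) :=
  lt_agSpectralRadius_of_weights
    ((isTriangleAttached_graphG2 hn).exists_weights (by rwa [Fintype.card_fin]) hR) h

theorem agSpectralRadius_graphG2_le {n : ℕ} (hn : 5 ≤ n) {D R : ℝ} (hD : (n : ℝ) - 2 = D)
    (hR : 4 ≤ R) (h : (D - 2) * (D + 1) ^ 2 / R +
        (D + 3) * ((2 * R * (D + 3) + 5 * (D + 2)) / (6 * R ^ 2 - 57)) +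
        (D + 2) * (((3 * R - 16 / R) * (D + 2) + 5 * (D + 3)) / (6 * R ^ 2 - 57)) ≤ R * D) :
    agSpectralRadius (graphG2 n) ≤ R / 2 :=
  agSpectralRadius_le_of_weights
    ((isTriangleAttached_graphG2 hn).exists_weights (by rwa [Fintype.card_fin]) hR) h

theorem lt_agSpectralRadius_graphG3 {n : ℕ} (hn : 5 ≤ n) {D R : ℝ} (hD : (n : ℝ) - 2 = D)
    (hR : 4 ≤ R) (h : R * D < (D - 3) * (D + 1) ^ 2 / R + (D + 2) ^ 2 / (R - 2) +
        (D + 2) ^ 2 * R / (2 * R ^ 2 - 9)) :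
    R / 2 < agSpectralRadius (graphG3 n) :=
  lt_agSpectralRadius_of_weights
    ((isTrianglePath_graphG3 hn).exists_weights (by rwa [Fintype.card_fin]) hR) h

theorem agSpectralRadius_graphG3_le {n : ℕ} (hn : 5 ≤ n) {D R : ℝ} (hD : (n : ℝ) - 2 = D)
    (hR : 4 ≤ R) (h : (D - 3) * (D + 1) ^ 2 / R + (D + 2) ^ 2 / (R - 2) +
        (D + 2) ^ 2 * R / (2 * R ^ 2 - 9) ≤ R * D) :
    agSpectralRadius (graphG3 n) ≤ R / 2 :=
  agSpectralRadius_le_of_weights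
    ((isTrianglePath_graphG3 hn).exists_weights (by rwa [Fintype.card_fin]) hR) h

/-- Expanding the centre equations with `D = n - 2` gives `2ρ = D + α + O(1/D)`, with `α = 3/2` for
`Sₙ + e`, `1/2` for `G₁`, `5/12` for `G₂` and `1/4` for `G₃`. This dictates the separators `3/2`,
`1/2`, `41/100` (just under `5/12`) and `1/4` used for large `n`. -/
theorem lt_agSpectralRadius_starPlusEdge_of_six_le {n : ℕ} (hn : 6 ≤ n) {D : ℝ}
    (hD : (n : ℝ) - 2 = D) : (D + 3 / 2) / 2 < agSpectralRadius (starPlusEdge n) := by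
  have hn' : (6 : ℝ) ≤ n := by exact_mod_cast hn
  -- Writing `D` as its least value plus `k ≥ 0` makes the cleared inequality a polynomial in `k`
  -- with nonnegative coefficients, which `positivity` recognises. The same device recurs below. The
  -- centre of `Sₙ + e` has degree `D + 1`.
  obtain ⟨k, rfl, hk⟩ : ∃ k, D = 4 + k ∧ 0 ≤ k := ⟨D - 4, by ring, by linarith⟩
  refine lt_agSpectralRadius_starPlusEdge (by omega) (D := 4 + k + 1) (by linarith) (by linarith) ?_
  rw [div_add_div _ _ (by linarith) (by linarith), lt_div_iff₀ (by nlinarith), ← sub_pos]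
  ring_nf
  positivity

theorem agSpectralRadius_graphG1_le_of_six_le {n : ℕ} (hn : 6 ≤ n) {D : ℝ}
    (hD : (n : ℝ) - 2 = D) : agSpectralRadius (graphG1 n) ≤ (D + 3 / 2) / 2 := by
  have hn' : (6 : ℝ) ≤ n := by exact_mod_cast hn
  obtain ⟨k, rfl, hk⟩ : ∃ k, D = 4 + k ∧ 0 ≤ k := ⟨D - 4, by ring, by linarith⟩
  refine agSpectralRadius_graphG1_le (by omega) hD (by linarith) ?_
  have h1 : 0 < (4 + k + 3 / 2) ^ 2 - 8 := by nlinarith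
  rw [div_add_div _ _ (by linarith) h1.ne', div_le_iff₀ (by positivity), ← sub_nonneg]
  ring_nf
  positivity

/-- Clears the nested `16 / R` in the centre row of `G₂`, so that its sign is that of a polynomial.
-/
theorem sub_triangleAttached_centre {A B C E F q R : ℝ} (hR : R ≠ 0) (hq : q ≠ 0) :
    E - (A / R + B * (C / q) + F * (((3 * R - 16 / R) * F + 5 * B) / q)) =
      (E * R * q - A * q - B * C * R - F * ((3 * R ^ 2 - 16) * F + 5 * B * R)) / (R * q) := by
  field_simp
  ring

theorem agSpectralRadius_graphG2_le_of_six_le {n : ℕ} (hn : 6 ≤ n) {D : ℝ}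
    (hD : (n : ℝ) - 2 = D) : agSpectralRadius (graphG2 n) ≤ (D + 3 / 2) / 2 := by
  have hn' : (6 : ℝ) ≤ n := by exact_mod_cast hn
  obtain ⟨k, rfl, hk⟩ : ∃ k, D = 4 + k ∧ 0 ≤ k := ⟨D - 4, by ring, by linarith⟩
  refine agSpectralRadius_graphG2_le (by omega) hD (by linarith) ?_
  have h1 : 0 < 6 * (4 + k + 3 / 2) ^ 2 - 57 := by nlinarith
  have h2 : 0 < 4 + k + 3 / 2 := by linarith
  rw [← sub_nonneg]
  rw [sub_triangleAttached_centre h2.ne' h1.ne']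
  refine div_nonneg ?_ (by positivity)
  ring_nf
  positivity

theorem lt_agSpectralRadius_graphG1_of_large {n : ℕ} (hn : 22 ≤ n) {D : ℝ}
    (hD : (n : ℝ) - 2 = D) : (D + 1 / 2) / 2 < agSpectralRadius (graphG1 n) := by
  have hn' : (22 : ℝ) ≤ n := by exact_mod_cast hn
  obtain ⟨k, rfl, hk⟩ : ∃ k, D = 20 + k ∧ 0 ≤ k := ⟨D - 20, by ring, by linarith⟩
  refine lt_agSpectralRadius_graphG1 (by omega) hD (by linarith) ?_
  have h1 : 0 < (20 + k + 1 / 2) ^ 2 - 8 := by nlinarith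
  rw [div_add_div _ _ (by linarith) h1.ne', lt_div_iff₀ (by positivity), ← sub_pos]
  ring_nf
  positivity

theorem agSpectralRadius_graphG2_le_of_large {n : ℕ} (hn : 22 ≤ n) {D : ℝ}
    (hD : (n : ℝ) - 2 = D) : agSpectralRadius (graphG2 n) ≤ (D + 1 / 2) / 2 := by
  have hn' : (22 : ℝ) ≤ n := by exact_mod_cast hn
  obtain ⟨k, rfl, hk⟩ : ∃ k, D = 20 + k ∧ 0 ≤ k := ⟨D - 20, by ring, by linarith⟩
  refine agSpectralRadius_graphG2_le (by omega) hD (by linarith) ?_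
  have h1 : 0 < 6 * (20 + k + 1 / 2) ^ 2 - 57 := by nlinarith
  have h2 : 0 < 20 + k + 1 / 2 := by linarith
  rw [← sub_nonneg, sub_triangleAttached_centre h2.ne' h1.ne']
  refine div_nonneg ?_ (by positivity)
  ring_nf
  positivity

theorem lt_agSpectralRadius_graphG2_of_large {n : ℕ} (hn : 16 ≤ n) {D : ℝ}
    (hD : (n : ℝ) - 2 = D) : (D + 41 / 100) / 2 < agSpectralRadius (graphG2 n) := by
  have hn' : (16 : ℝ) ≤ n := by exact_mod_cast hn
  obtain ⟨k, rfl, hk⟩ : ∃ k, D = 14 + k ∧ 0 ≤ k := ⟨D - 14, by ring, by linarith⟩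
  refine lt_agSpectralRadius_graphG2 (by omega) hD (by linarith) ?_
  have h1 : 0 < 6 * (14 + k + 41 / 100) ^ 2 - 57 := by nlinarith
  have h2 : 0 < 14 + k + 41 / 100 := by linarith
  rw [← sub_neg, sub_triangleAttached_centre h2.ne' h1.ne']
  refine div_neg_of_neg_of_pos (neg_pos.1 ?_) (by positivity)
  ring_nf
  positivity

theorem agSpectralRadius_graphG3_le_of_large {n : ℕ} (hn : 16 ≤ n) {D : ℝ}
    (hD : (n : ℝ) - 2 = D) : agSpectralRadius (graphG3 n) ≤ (D + 41 / 100) / 2 := by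
  have hn' : (16 : ℝ) ≤ n := by exact_mod_cast hn
  obtain ⟨k, rfl, hk⟩ : ∃ k, D = 14 + k ∧ 0 ≤ k := ⟨D - 14, by ring, by linarith⟩
  refine agSpectralRadius_graphG3_le (by omega) hD (by linarith) ?_
  have h1 : 0 < 2 * (14 + k + 41 / 100) ^ 2 - 9 := by nlinarith
  have h2 : 0 < 14 + k + 41 / 100 := by linarith
  have h3 : 0 < 14 + k + 41 / 100 - 2 := by linarith
  rw [div_add_div _ _ h2.ne' h3.ne', div_add_div _ _ (by positivity) h1.ne',
    div_le_iff₀ (by positivity), ← sub_nonneg]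
  ring_nf
  positivity

theorem lt_agSpectralRadius_graphG3_of_large {n : ℕ} (hn : 19 ≤ n) {D : ℝ}
    (hD : (n : ℝ) - 2 = D) : (D + 1 / 4) / 2 < agSpectralRadius (graphG3 n) := by
  have hn' : (19 : ℝ) ≤ n := by exact_mod_cast hn
  obtain ⟨k, rfl, hk⟩ : ∃ k, D = 17 + k ∧ 0 ≤ k := ⟨D - 17, by ring, by linarith⟩
  refine lt_agSpectralRadius_graphG3 (by omega) hD (by linarith) ?_
  have h1 : 0 < 2 * (17 + k + 1 / 4) ^ 2 - 9 := by nlinarith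
  have h2 : 0 < 17 + k + 1 / 4 := by linarith
  have h3 : 0 < 17 + k + 1 / 4 - 2 := by linarith
  rw [div_add_div _ _ h2.ne' h3.ne', div_add_div _ _ (by positivity) h1.ne',
    lt_div_iff₀ (by positivity), ← sub_pos]
  ring_nf
  positivity

theorem lt_agSpectralRadius_graphG3_of_ten_le {n : ℕ} (hn : 10 ≤ n) {D : ℝ}
    (hD : (n : ℝ) - 2 = D) : (D + 4 / (D - 1)) / 2 < agSpectralRadius (graphG3 n) := by
  by_cases hlarge : 19 ≤ n
  · have hn' : (19 : ℝ) ≤ n := by exact_mod_cast hlarge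
    refine lt_of_le_of_lt ?_ (lt_agSpectralRadius_graphG3_of_large hlarge hD)
    -- Here `4/(D - 1) ≤ 1/4` means `D ≥ 17`, which is the origin of the cut at `n = 19`.
    have : 4 / (D - 1) ≤ 1 / 4 := by rw [div_le_div_iff₀ (by linarith) (by norm_num)]; linarith
    linarith
  · subst hD
    interval_cases n <;>
      exact lt_agSpectralRadius_graphG3 (by norm_num) rfl (by norm_num) (by norm_num)

theorem agSpectralRadius_graphG1_lt_graphG2 {n : ℕ} (hn : 5 ≤ n) (hn' : n ≤ 15) :
    agSpectralRadius (graphG1 n) < agSpectralRadius (graphG2 n) := by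
  have key : ∀ R : ℝ, 4 ≤ R →
      (((n : ℝ) - 2) - 2) * (((n : ℝ) - 2) + 1) ^ 2 / R +
        (((n : ℝ) - 2) + 2) ^ 2 * R / (R ^ 2 - 8) ≤ R * ((n : ℝ) - 2) →
      R * ((n : ℝ) - 2) < (((n : ℝ) - 2) - 2) * (((n : ℝ) - 2) + 1) ^ 2 / R +
        (((n : ℝ) - 2) + 3) * ((2 * R * (((n : ℝ) - 2) + 3) + 5 * (((n : ℝ) - 2) + 2)) /
          (6 * R ^ 2 - 57)) +
        (((n : ℝ) - 2) + 2) * (((3 * R - 16 / R) * (((n : ℝ) - 2) + 2) +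
          5 * (((n : ℝ) - 2) + 3)) / (6 * R ^ 2 - 57)) →
      agSpectralRadius (graphG1 n) < agSpectralRadius (graphG2 n) := fun R hR h1 h2 =>
    (agSpectralRadius_graphG1_le hn rfl hR h1).trans_lt (lt_agSpectralRadius_graphG2 hn rfl hR h2)
  -- Each decimal separates `2ρ(G₁)` from `2ρ(G₂)`; near the change of order between `n = 15` and `n
  -- = 16` the separators are given to three decimals.
  interval_cases n
  · exact key 4.5 (by norm_num) (by norm_num) (by norm_num)
  · exact key 5.2 (by norm_num) (by norm_num) (by norm_num)
  · exact key 6 (by norm_num) (by norm_num) (by norm_num)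
  · exact key 6.85 (by norm_num) (by norm_num) (by norm_num)
  · exact key 7.75 (by norm_num) (by norm_num) (by norm_num)
  · exact key 8.7 (by norm_num) (by norm_num) (by norm_num)
  · exact key 9.65 (by norm_num) (by norm_num) (by norm_num)
  · exact key 10.62 (by norm_num) (by norm_num) (by norm_num)
  · exact key 11.595 (by norm_num) (by norm_num) (by norm_num)
  · exact key 12.577 (by norm_num) (by norm_num) (by norm_num)
  · exact key 13.564 (by norm_num) (by norm_num) (by norm_num)

theorem agSpectralRadius_graphG2_lt_graphG1 {n : ℕ} (hn : 16 ≤ n) :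
    agSpectralRadius (graphG2 n) < agSpectralRadius (graphG1 n) := by
  by_cases hlarge : 22 ≤ n
  · exact (agSpectralRadius_graphG2_le_of_large hlarge rfl).trans_lt
      (lt_agSpectralRadius_graphG1_of_large hlarge rfl)
  have key : ∀ R : ℝ, 4 ≤ R →
      (((n : ℝ) - 2) - 2) * (((n : ℝ) - 2) + 1) ^ 2 / R +
        (((n : ℝ) - 2) + 3) * ((2 * R * (((n : ℝ) - 2) + 3) + 5 * (((n : ℝ) - 2) + 2)) /
          (6 * R ^ 2 - 57)) +
        (((n : ℝ) - 2) + 2) * (((3 * R - 16 / R) * (((n : ℝ) - 2) + 2) +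
          5 * (((n : ℝ) - 2) + 3)) / (6 * R ^ 2 - 57)) ≤ R * ((n : ℝ) - 2) →
      R * ((n : ℝ) - 2) < (((n : ℝ) - 2) - 2) * (((n : ℝ) - 2) + 1) ^ 2 / R +
        (((n : ℝ) - 2) + 2) ^ 2 * R / (R ^ 2 - 8) →
      agSpectralRadius (graphG2 n) < agSpectralRadius (graphG1 n) := fun R hR h1 h2 =>
    (agSpectralRadius_graphG2_le (by omega) rfl hR h1).trans_lt
      (lt_agSpectralRadius_graphG1 (by omega) rfl hR h2)
  interval_cases n
  · exact key 14.553 (by norm_num) (by norm_num) (by norm_num)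
  · exact key 15.544 (by norm_num) (by norm_num) (by norm_num)
  · exact key 16.536 (by norm_num) (by norm_num) (by norm_num)
  · exact key 17.53 (by norm_num) (by norm_num) (by norm_num)
  · exact key 18.52 (by norm_num) (by norm_num) (by norm_num)
  · exact key 19.52 (by norm_num) (by norm_num) (by norm_num)

theorem agSpectralRadius_graphG3_lt_graphG1 {n : ℕ} (hn : 8 ≤ n) (hn' : n ≤ 15) :
    agSpectralRadius (graphG3 n) < agSpectralRadius (graphG1 n) := by
  have key : ∀ R : ℝ, 4 ≤ R →
      (((n : ℝ) - 2) - 3) * (((n : ℝ) - 2) + 1) ^ 2 / R + (((n : ℝ) - 2) + 2) ^ 2 / (R - 2) +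
        (((n : ℝ) - 2) + 2) ^ 2 * R / (2 * R ^ 2 - 9) ≤ R * ((n : ℝ) - 2) →
      R * ((n : ℝ) - 2) < (((n : ℝ) - 2) - 2) * (((n : ℝ) - 2) + 1) ^ 2 / R +
        (((n : ℝ) - 2) + 2) ^ 2 * R / (R ^ 2 - 8) →
      agSpectralRadius (graphG3 n) < agSpectralRadius (graphG1 n) := fun R hR h1 h2 =>
    (agSpectralRadius_graphG3_le (by omega) rfl hR h1).trans_lt
      (lt_agSpectralRadius_graphG1 (by omega) rfl hR h2)
  interval_cases n
  · exact key 6.752 (by norm_num) (by norm_num) (by norm_num)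
  · exact key 7.67 (by norm_num) (by norm_num) (by norm_num)
  · exact key 8.6 (by norm_num) (by norm_num) (by norm_num)
  · exact key 9.57 (by norm_num) (by norm_num) (by norm_num)
  · exact key 10.55 (by norm_num) (by norm_num) (by norm_num)
  · exact key 11.52 (by norm_num) (by norm_num) (by norm_num)
  · exact key 12.5 (by norm_num) (by norm_num) (by norm_num)
  · exact key 13.5 (by norm_num) (by norm_num) (by norm_num)

theorem agSpectralRadius_graphG1_lt_graphG3 {n : ℕ} (hn : 5 ≤ n) (hn' : n ≤ 7) :
    agSpectralRadius (graphG1 n) < agSpectralRadius (graphG3 n) := by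
  have key : ∀ R : ℝ, 4 ≤ R →
      (((n : ℝ) - 2) - 2) * (((n : ℝ) - 2) + 1) ^ 2 / R +
        (((n : ℝ) - 2) + 2) ^ 2 * R / (R ^ 2 - 8) ≤ R * ((n : ℝ) - 2) →
      R * ((n : ℝ) - 2) < (((n : ℝ) - 2) - 3) * (((n : ℝ) - 2) + 1) ^ 2 / R +
        (((n : ℝ) - 2) + 2) ^ 2 / (R - 2) +
        (((n : ℝ) - 2) + 2) ^ 2 * R / (2 * R ^ 2 - 9) →
      agSpectralRadius (graphG1 n) < agSpectralRadius (graphG3 n) := fun R hR h1 h2 =>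
    (agSpectralRadius_graphG1_le hn rfl hR h1).trans_lt (lt_agSpectralRadius_graphG3 hn rfl hR h2)
  interval_cases n
  · exact key 4.45 (by norm_num) (by norm_num) (by norm_num)
  · exact key 5.1 (by norm_num) (by norm_num) (by norm_num)
  · exact key 5.88 (by norm_num) (by norm_num) (by norm_num)

/-- Only the ranges where `G₂` and `G₃` are consecutive in the order; for `8 ≤ n ≤ 15` the graph
`G₁` lies between them. -/
theorem agSpectralRadius_graphG3_lt_graphG2 {n : ℕ} (hn : 5 ≤ n) (h : n ≤ 7 ∨ 16 ≤ n) :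
    agSpectralRadius (graphG3 n) < agSpectralRadius (graphG2 n) := by
  rcases h with h | h
  · have key : ∀ R : ℝ, 4 ≤ R →
        (((n : ℝ) - 2) - 3) * (((n : ℝ) - 2) + 1) ^ 2 / R + (((n : ℝ) - 2) + 2) ^ 2 / (R - 2) +
          (((n : ℝ) - 2) + 2) ^ 2 * R / (2 * R ^ 2 - 9) ≤ R * ((n : ℝ) - 2) →
        R * ((n : ℝ) - 2) < (((n : ℝ) - 2) - 2) * (((n : ℝ) - 2) + 1) ^ 2 / R +
          (((n : ℝ) - 2) + 3) * ((2 * R * (((n : ℝ) - 2) + 3) + 5 * (((n : ℝ) - 2) + 2)) /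
            (6 * R ^ 2 - 57)) +
          (((n : ℝ) - 2) + 2) * (((3 * R - 16 / R) * (((n : ℝ) - 2) + 2) +
            5 * (((n : ℝ) - 2) + 3)) / (6 * R ^ 2 - 57)) →
        agSpectralRadius (graphG3 n) < agSpectralRadius (graphG2 n) := fun R hR h1 h2 =>
      (agSpectralRadius_graphG3_le hn rfl hR h1).trans_lt
        (lt_agSpectralRadius_graphG2 hn rfl hR h2)
    interval_cases n
    · exact key 4.7 (by norm_num) (by norm_num) (by norm_num)
    · exact key 5.25 (by norm_num) (by norm_num) (by norm_num)
    · exact key 6 (by norm_num) (by norm_num) (by norm_num)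
  · exact (agSpectralRadius_graphG3_le_of_large h rfl).trans_lt
      (lt_agSpectralRadius_graphG2_of_large h rfl)

theorem agSpectralRadius_graphG2_lt_starPlusEdge {n : ℕ} (hn : 5 ≤ n) :
    agSpectralRadius (graphG2 n) < agSpectralRadius (starPlusEdge n) := by
  by_cases h : 6 ≤ n
  · exact (agSpectralRadius_graphG2_le_of_six_le h rfl).trans_lt
      (lt_agSpectralRadius_starPlusEdge_of_six_le h rfl)
  · obtain rfl : n = 5 := by omega
    exact (agSpectralRadius_graphG2_le (R := 4.9) le_rfl rfl (by norm_num) (by norm_num)).trans_lt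
      (lt_agSpectralRadius_starPlusEdge le_rfl rfl (by norm_num) (by norm_num))

theorem agSpectralRadius_graphG1_lt_starPlusEdge {n : ℕ} (hn : 6 ≤ n) :
    agSpectralRadius (graphG1 n) < agSpectralRadius (starPlusEdge n) :=
  (agSpectralRadius_graphG1_le_of_six_le hn rfl).trans_lt
    (lt_agSpectralRadius_starPlusEdge_of_six_le hn rfl)

/-! ### Classification and conclusion. -/

open scoped Classical in
/-- A unicyclic graph of order `n` which is none of `Sₙ + e`, `G₁`, `G₂`, `G₃` has maximal degree
at most `n - 3`. -/
theorem IsUnicyclic.nonempty_iso_or_degree_le {V : Type u} [Fintype V] {G : SimpleGraph V}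
    (hG : IsUnicyclic G) {n : ℕ} (hn : 5 ≤ n) (hV : Fintype.card V = n) :
    Nonempty (G ≃g starPlusEdge n) ∨ Nonempty (G ≃g graphG1 n) ∨ Nonempty (G ≃g graphG2 n) ∨
      Nonempty (G ≃g graphG3 n) ∨ ∀ i, G.degree i ≤ n - 3 := by
  have hV' : Fintype.card V = Fintype.card (Fin n) := by rw [hV, Fintype.card_fin]
  by_cases h1 : ∃ c, G.degree c + 1 = Fintype.card V
  · obtain ⟨c, hc⟩ := h1
    obtain ⟨a, b, h⟩ := hG.exists_isStarPlusEdge hc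
    exact Or.inl (h.nonempty_iso (isStarPlusEdge_starPlusEdge hn) hV')
  by_cases h2 : ∃ c, G.degree c + 2 = Fintype.card V
  · obtain ⟨c, hc⟩ := h2
    rcases hG.exists_of_degree_add_two hc with ⟨p, q, o, h⟩ | ⟨p, q, w, h⟩ | ⟨a, b, s, w, h⟩
    · exact Or.inr (Or.inl (h.nonempty_iso (isQuadrangleStar_graphG1 hn) hV'))
    · exact Or.inr (Or.inr (Or.inl (h.nonempty_iso (isTriangleAttached_graphG2 hn) hV')))
    · exact Or.inr (Or.inr (Or.inr (Or.inl (h.nonempty_iso (isTrianglePath_graphG3 hn) hV'))))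
  · push Not at h1 h2
    refine Or.inr (Or.inr (Or.inr (Or.inr fun i => ?_)))
    have := G.degree_lt_card_verts i
    have := h1 i
    have := h2 i
    omega

-- For `n ≤ 7` the smallest of the four is `G₁`; the bounds `4`, `5.056` and `5.86` on `2ρ(G)` are
-- all below `2ρ(G₁)`.
open scoped Classical in
theorem IsUnicyclic.agSpectralRadius_lt_graphG1 {V : Type u} [Fintype V] {G : SimpleGraph V}
    (hG : IsUnicyclic G) {n : ℕ} (hn : 5 ≤ n) (hn' : n ≤ 7) (hV : Fintype.card V = n)
    (hdeg : ∀ i, G.degree i ≤ n - 3) : agSpectralRadius G < agSpectralRadius (graphG1 n) := by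
  interval_cases n
  · exact (hG.agSpectralRadius_le_of_five hV hdeg).trans_lt
      (lt_agSpectralRadius_graphG1 (by norm_num) rfl (by norm_num) (by norm_num))
  · exact (hG.agSpectralRadius_le_of_six hV hdeg).trans_lt
      (lt_agSpectralRadius_graphG1 (by norm_num) rfl (by norm_num) (by norm_num))
  · exact (hG.agSpectralRadius_le_of_seven hV hdeg).trans_lt
      (lt_agSpectralRadius_graphG1 (by norm_num) rfl (by norm_num) (by norm_num))

-- From `n = 8` on, `G₃` is the smallest of the four, so it is the one to beat.
open scoped Classical in
theorem IsUnicyclic.agSpectralRadius_lt_graphG3 {V : Type u} [Fintype V] {G : SimpleGraph V}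
    (hG : IsUnicyclic G) {n : ℕ} (hn : 8 ≤ n) (hV : Fintype.card V = n)
    (hdeg : ∀ i, G.degree i ≤ n - 3) : agSpectralRadius G < agSpectralRadius (graphG3 n) := by
  by_cases h10 : 10 ≤ n
  · subst hV
    exact (hG.agSpectralRadius_le_of_ten_le h10 hdeg rfl).trans_lt
      (lt_agSpectralRadius_graphG3_of_ten_le h10 rfl)
  · interval_cases n
    · exact (hG.agSpectralRadius_le_of_eight hV hdeg).trans_lt
        (lt_agSpectralRadius_graphG3 (by norm_num) rfl (by norm_num) (by norm_num))
    · exact (hG.agSpectralRadius_le_of_nine hV hdeg).trans_lt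
        (lt_agSpectralRadius_graphG3 (by norm_num) rfl (by norm_num) (by norm_num))

end AGSpectral

theorem mainTheorem1 (n : ℕ) (hn : 5 ≤ n) :
    AGSpectral.IsUniqueSmallest.{u} n (SimpleGraph.cycleGraph n) ∧
    AGSpectral.agSpectralRadius (SimpleGraph.cycleGraph n) = 2 ∧
    (n ≤ 7 → AGSpectral.AreUniqueFirstFour.{u} n (AGSpectral.starPlusEdge n)
      (AGSpectral.graphG2 n) (AGSpectral.graphG3 n) (AGSpectral.graphG1 n)) ∧
    (8 ≤ n → n ≤ 15 → AGSpectral.AreUniqueFirstFour.{u} n (AGSpectral.starPlusEdge n)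
      (AGSpectral.graphG2 n) (AGSpectral.graphG1 n) (AGSpectral.graphG3 n)) ∧
    (16 ≤ n → AGSpectral.AreUniqueFirstFour.{u} n (AGSpectral.starPlusEdge n)
      (AGSpectral.graphG1 n) (AGSpectral.graphG2 n) (AGSpectral.graphG3 n)) := by
  have uS := (AGSpectral.isStarPlusEdge_starPlusEdge hn).isUnicyclic
  have u1 := (AGSpectral.isQuadrangleStar_graphG1 hn).isUnicyclic
  have u2 := (AGSpectral.isTriangleAttached_graphG2 hn).isUnicyclic
  have u3 := (AGSpectral.isTrianglePath_graphG3 hn).isUnicyclic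
  refine ⟨AGSpectral.isUniqueSmallest_cycleGraph hn, AGSpectral.agSpectralRadius_cycleGraph hn,
    fun h7 => ⟨⟨uS, u2, u3, u1⟩, ⟨AGSpectral.agSpectralRadius_graphG2_lt_starPlusEdge hn,
      AGSpectral.agSpectralRadius_graphG3_lt_graphG2 hn (Or.inl h7),
      AGSpectral.agSpectralRadius_graphG1_lt_graphG3 hn h7⟩, fun V _ G hV hG => ?_⟩,
    fun h8 h15 => ⟨⟨uS, u2, u1, u3⟩, ⟨AGSpectral.agSpectralRadius_graphG2_lt_starPlusEdge hn,
      AGSpectral.agSpectralRadius_graphG1_lt_graphG2 hn h15,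
      AGSpectral.agSpectralRadius_graphG3_lt_graphG1 h8 h15⟩, fun V _ G hV hG => ?_⟩,
    fun h16 => ⟨⟨uS, u1, u2, u3⟩,
      ⟨AGSpectral.agSpectralRadius_graphG1_lt_starPlusEdge (by omega),
      AGSpectral.agSpectralRadius_graphG2_lt_graphG1 h16,
      AGSpectral.agSpectralRadius_graphG3_lt_graphG2 hn (Or.inr h16)⟩, fun V _ G hV hG => ?_⟩⟩
  -- The classification lists `Sₙ + e`, `G₁`, `G₂`, `G₃` in a fixed order; each range of `n`
  -- permutes the alternatives and supplies its own last graph.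
  · rcases hG.nonempty_iso_or_degree_le hn hV with h | h | h | h | h
    · exact Or.inl h
    · exact Or.inr (Or.inr (Or.inr (Or.inl h)))
    · exact Or.inr (Or.inl h)
    · exact Or.inr (Or.inr (Or.inl h))
    · exact Or.inr (Or.inr (Or.inr (Or.inr (hG.agSpectralRadius_lt_graphG1 hn h7 hV h))))
  · rcases hG.nonempty_iso_or_degree_le hn hV with h | h | h | h | h
    · exact Or.inl h
    · exact Or.inr (Or.inr (Or.inl h))
    · exact Or.inr (Or.inl h)
    · exact Or.inr (Or.inr (Or.inr (Or.inl h)))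
    · exact Or.inr (Or.inr (Or.inr (Or.inr (hG.agSpectralRadius_lt_graphG3 h8 hV h))))
  · rcases hG.nonempty_iso_or_degree_le hn hV with h | h | h | h | h
    · exact Or.inl h
    · exact Or.inr (Or.inl h)
    · exact Or.inr (Or.inr (Or.inl h))
    · exact Or.inr (Or.inr (Or.inr (Or.inl h)))
    · exact Or.inr (Or.inr (Or.inr (Or.inr (hG.agSpectralRadius_lt_graphG3 (by omega) hV h))))
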